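/- Let $n\ge 1$ and let $I=\{0,1\}^n$; for $\mathbf i\in I$ let $\bar{\mathbf i}$ be the index with all digits switched. For nonzero scalars $z_1,\dots,z_n$ put $z^{\mathbf i}=\prod_{k=1}^n z_k^{1-2\mathbf i(k)}$. Let $\mathcal V^{+}$ be the set of functions $I\to[0,\infty)$, and $\mathcal V^{\rm sa}$ the real vector space of functions $u:I\to\mathbb C$ with $u_{\bar{\mathbf i}}=\overline{u_{\mathbf i}}$. For $s,a\in\mathcal V^{+}$ and $u,c\in\mathcal V^{\rm sa}$ put $$\delta(s)=\inf_{r\in(0,\infty)^n}\sum_{\mathbf i}s_{\mathbf i}r^{\mathbf i},\quad \|u\|_{X}=\sup_{\alpha\in\mathbb T^n}\sum_{\mathbf i}u_{\mathbf i}\alpha^{\mathbf i},$$ $$\Delta(a)=\inf\Big\{\sum_{\mathbf i} s_{\mathbf i}a_{\mathbf i}: s\in\mathcal V^+,\ \delta(s)=1\Big\},\quad \|c\|'=\sup\Big\{\sum_{\mathbf i} u_{\mathbf i}c_{\mathbf i}: u\in\mathcal V^{\rm sa},\ \|u\|_{X}=1\Big\}.$$ Let $X(s,u)$ be the $n$-qubit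 matrix, indexed by $I\times I$, with $(\mathbf i,\mathbf i)$ entry $s_{\mathbf i}$, $(\mathbf i,\bar{\mathbf i})$ entry $u_{\mathbf i}$, and all other entries $0$. Let $\Theta:\mathbb R^n\to\mathbb R^I$ be the linear map $\Theta(x)_{\mathbf i}=\sum_k(1-2\mathbf i(k))x_k$. Say that $c\in\mathcal V^{\rm sa}$ has trivial phase difference if $c_{\mathbf i}=|c_{\mathbf i}|e^{{\rm i}\theta_{\mathbf i}}$ for all $\mathbf i$ with some $\theta\in\operatorname{Im}\Theta$, and nontrivial phase difference otherwise. Let $\mathcal D$, $\mathcal T$, $\mathcal S$ be the sets of all $n$-qubit states, of PPT states (states all of whose partial transposes, with respect to every subset of the qubits, are positive semidefinite), and of fully separable states. Let $\mathcal C$ be the set of states $\varrho$ such that $\Delta(a)\ge\|c\|'$, where $a_{\mathbf i}=\varrho_{\mathbf i,\mathbf i}$ and $c_{\mathbf i}=\varrho_{\mathbf i,\bar{\mathbf i}}$. Interiors are taken relative to the affine space of self-adjoint matrices of trace one, and a boundary point of a set is a point of that set which is not an interior point. "Full ranks" means that all partial transposes, including the matrix itself, have rank $2^n$. Then the following hold.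 1. $\mathcal S\subset\mathcal C\cap\mathcal T$, and $\mathcal C$ is convex and closed. 2. Let $c\in\mathcal V^{\rm sa}$ with $|c_{\mathbf i}|=1$ for all $\mathbf i$, and let $\varrho_t=2^{-n}X(\mathbf 1,tc)$. For every $t\ge0$, $$\varrho_t\in\mathcal D\iff\varrho_t\in\mathcal T\iff t\le1,$$ $$\varrho_t\in\mathcal S\iff\varrho_t\in\mathcal C\cap\mathcal T\iff\Delta(\mathbf 1)\ge\|tc\|'\iff t\le 1/\|c\|'.$$ If moreover $c$ has nontrivial phase difference, then $t_0=1/\|c\|'$ satisfies $0<t_0<1$, and $\varrho_{t_0}$ is a boundary point of $\mathcal C\cap\mathcal T$ and of $\mathcal S$, an interior point of $\mathcal T$, and has full ranks. 3. There is $c\in\mathcal V^{\rm sa}$ with $|c_{\mathbf i}|=1$ for all $\mathbf i$ and with nontrivial phase difference if and only if $n\ge3$. 4. If $n\ge3$, then $\mathcal T\setminus(\mathcal C\cap\mathcal T)$, a set of PPT entangled states, has nonempty interior; and there exist boundary points of $\mathcal S$ (boundary separable states) with full ranks. -/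

import Mathlib

open scoped ComplexOrder Topology

namespace XState

/-- The set `I_[n]` of `n`-bit indices. -/
abbrev Idx (n : ℕ) : Type := Fin n → Fin 2

/-- `n`-qubit matrices, i.e. elements of `M₂ ⊗ ⋯ ⊗ M₂`. -/
abbrev QMat (n : ℕ) : Type := Matrix (Idx n) (Idx n) ℂ

/-- The index obtained from `i` by switching all its digits (addition in `Fin 2` is modulo 2). -/
def bar {n : ℕ} (i : Idx n) : Idx n := fun k => i k + 1

/-- The nonnegative functions on `I_[n]`. -/
def VPos (n : ℕ) : Set (Idx n → ℝ) := {s | ∀ i, 0 ≤ s i}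

/-- The complex functions `u` on `I_[n]` such that `u (bar i)` is the conjugate of `u i`. -/
def VSa (n : ℕ) : Set (Idx n → ℂ) := {u | ∀ i, u (bar i) = star (u i)}

/-- The X-shaped matrix `X(s,u)`. -/
def X {n : ℕ} (s : Idx n → ℝ) (u : Idx n → ℂ) : QMat n :=
  Matrix.of fun i j => if j = i then (s i : ℂ) else if j = bar i then u i else 0

/-- `z^i = ∏ₖ zₖ^(1 - 2 i(k))`. -/
def monom {K : Type*} [Field K] {n : ℕ} (z : Fin n → K) (i : Idx n) : K :=
  ∏ k, z k ^ ((1 : ℤ) - 2 * (((i k : Fin 2) : ℕ) : ℤ))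

/-- `δₙ(s)`: the infimum over `r ∈ (0,∞)ⁿ` of `∑ᵢ sᵢ r^i`. -/
noncomputable def delta {n : ℕ} (s : Idx n → ℝ) : ℝ :=
  sInf {x | ∃ r : Fin n → ℝ, (∀ k, 0 < r k) ∧ x = ∑ i, s i * monom r i}

/-- `‖u‖_Xₙ`: the supremum over `α ∈ 𝕋ⁿ` of `∑ᵢ uᵢ α^i`, a real number for `u ∈ VSa n`. -/
noncomputable def xNorm {n : ℕ} (u : Idx n → ℂ) : ℝ :=
  sSup {x | ∃ α : Fin n → ℂ, (∀ k, ‖α k‖ = 1) ∧ x = (∑ i, u i * monom α i).re}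

/-- `Δₙ(a)`: the infimum of `⟨s,a⟩` over nonnegative `s` with `δₙ(s) = 1`. -/
noncomputable def Delta {n : ℕ} (a : Idx n → ℝ) : ℝ :=
  sInf {x | ∃ s ∈ VPos n, delta s = 1 ∧ x = ∑ i, s i * a i}

/-- `‖c‖′_Xₙ`: the supremum of `⟨u,c⟩` (real for `u, c ∈ VSa n`) over `u ∈ VSa n` with
`‖u‖_Xₙ = 1`. -/
noncomputable def xDualNorm {n : ℕ} (c : Idx n → ℂ) : ℝ :=
  sSup {x | ∃ u ∈ VSa n, xNorm u = 1 ∧ x = (∑ i, u i * c i).re}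

/-- The linear map `Θₙ : ℝⁿ → ℝ^(I_[n])`. -/
noncomputable def Theta (n : ℕ) : (Fin n → ℝ) →ₗ[ℝ] (Idx n → ℝ) :=
  Matrix.mulVecLin (Matrix.of fun (i : Idx n) (k : Fin n) => if i k = 0 then (1 : ℝ) else -1)

/-- `θ` is a phase part of `c`: `θ (bar i) = - θ i`, and `c i = |c i| e^(i θ i)`.
It is determined only modulo `2π` in each entry. -/
def IsPhasePart {n : ℕ} (c : Idx n → ℂ) (θ : Idx n → ℝ) : Prop :=
  (∀ i, θ (bar i) = - θ i) ∧ ∀ i, c i = (‖c i‖ : ℂ) * Complex.exp ((θ i : ℂ) * Complex.I)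

/-- `c` has trivial phase difference: it has a phase part satisfying the phase identities,
that is, one in the image of `Θₙ`. -/
def TrivialPhaseDifference {n : ℕ} (c : Idx n → ℂ) : Prop :=
  ∃ θ, IsPhasePart c θ ∧ θ ∈ LinearMap.range (Theta n)

/-- The tensor product of `2 × 2` matrices. -/
def tensor {n : ℕ} (A : Fin n → Matrix (Fin 2) (Fin 2) ℂ) : QMat n :=
  Matrix.of fun i j => ∏ k, A k (i k) (j k)

/-- The partial transpose with respect to the qubits in `S`. -/
def partialTranspose {n : ℕ} (S : Finset (Fin n)) (ρ : QMat n) : QMat n :=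
  Matrix.of fun i j =>
    ρ (fun k => if k ∈ S then j k else i k) (fun k => if k ∈ S then i k else j k)

/-- The affine space of self-adjoint matrices of trace one. -/
def saTraceOne (n : ℕ) : Set (QMat n) := {ρ | ρ.IsHermitian ∧ ρ.trace = 1}

/-- The set `𝒟` of all states. -/
def states (n : ℕ) : Set (QMat n) := {ρ | ρ.PosSemidef ∧ ρ.trace = 1}

/-- The set `𝒯` of PPT states: the states all of whose partial transposes are positive. -/
def pptStates (n : ℕ) : Set (QMat n) :=
  {ρ | ρ ∈ states n ∧ ∀ S : Finset (Fin n), (partialTranspose S ρ).PosSemidef}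

/-- Pure product states `|x₁⟩⟨x₁| ⊗ ⋯ ⊗ |xₙ⟩⟨xₙ|` with unit vectors `xₖ ∈ ℂ²`. -/
def pureProductStates (n : ℕ) : Set (QMat n) :=
  {ρ | ∃ x : Fin n → Fin 2 → ℂ, (∀ k, ∑ b, ‖x k b‖ ^ 2 = 1) ∧
    ρ = tensor fun k => Matrix.vecMulVec (x k) (star (x k))}

/-- The set `𝒮` of (fully) separable states. -/
def separableStates (n : ℕ) : Set (QMat n) := convexHull ℝ (pureProductStates n)

/-- The diagonal part of a self-adjoint matrix. -/
def diagPart {n : ℕ} (ρ : QMat n) : Idx n → ℝ := fun i => (ρ i i).re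

/-- The anti-diagonal part. -/
def antidiagPart {n : ℕ} (ρ : QMat n) : Idx n → ℂ := fun i => ρ i (bar i)

/-- The set `𝒞` of states with X-part `X(a,c)` satisfying `Δₙ(a) ≥ ‖c‖′_Xₙ`. -/
def criterionStates (n : ℕ) : Set (QMat n) :=
  {ρ | ρ ∈ states n ∧ Delta (diagPart ρ) ≥ xDualNorm (antidiagPart ρ)}

/-- Interior of a set of matrices relative to the affine space of self-adjoint matrices of
trace one. -/
def relInterior {n : ℕ} (A : Set (QMat n)) : Set (QMat n) :=
  {ρ | ρ ∈ saTraceOne n ∧ A ∈ 𝓝[saTraceOne n] ρ}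

/-- Boundary points of `A`: the points of `A` that are not relative interior points. -/
def relBoundary {n : ℕ} (A : Set (QMat n)) : Set (QMat n) := A \ relInterior A

/-- All partial transposes, including the matrix itself (`S = ∅`), have full rank. -/
def HasFullRanks {n : ℕ} (ρ : QMat n) : Prop :=
  ∀ S : Finset (Fin n), (partialTranspose S ρ).rank = 2 ^ n

/-- `ϱ_t = 2⁻ⁿ X(1, t c)`. -/
noncomputable def rho {n : ℕ} (c : Idx n → ℂ) (t : ℝ) : QMat n :=
  ((2 : ℝ) ^ n)⁻¹ • X 1 (t • c)

end XState

/-! The X-part of a pure product state either has zero anti-diagonal or is `p • monom r`, `p • monom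
α` with `p ≥ 0`, `r` positive and `α` on the torus. Hence `⟨u,c⟩ ≤ p‖u‖_X = p = p δ(s) ≤ ⟨s,a⟩`
whenever `δ(s) = ‖u‖_X = 1`. Among states, the criterion is exactly this family of linear
inequalities in `ϱ`, so `𝒞` is convex and closed and contains every separable state.

For uniform diagonal the criterion is also sufficient. Since `Δ(1) = 1`, it reads `‖tc‖' ≤ 1`, and
by Hahn–Banach `tc` is then a convex combination of monomial vectors
(`mem_convexHull_of_xDualNorm_le_one`). Each monomial vector gives a separable X-state, an average
of product states (`X_monom_mem_separableStates`). So `ϱ_t` is separable exactly up to `t₀ =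
1/‖c‖'`.

Partial transposition only permutes the anti-diagonal of `ϱ_t`, so all partial transposes are
bounded below by `2⁻ⁿ(1 - t)`: positive up to `t = 1`, definite and stable under perturbation before
that.

The gap `t₀ < 1` comes from pairing `c` with its conjugate: `2ⁿ ≤ ‖c̄‖_X ‖c‖'`, while `‖c̄‖_X = 2ⁿ`
would force `c` to be a monomial vector, which means trivial phase difference. Monomials satisfy a
four-term multiplicative relation that a unimodular `c` can violate once `n ≥ 3`; for `n ≤ 2` the
phases can be solved for. -/

namespace XState

/-! ### Compactness of convex hulls in finite dimension -/

section ConvexHull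

variable {E : Type*} [AddCommGroup E] [Module ℝ E]

/-- The points that are convex combinations of `m + 1` points of `s`. -/
def iteratedConvexJoin (s : Set E) : ℕ → Set E
  | 0 => s
  | m + 1 => convexJoin ℝ s (iteratedConvexJoin s m)

lemma iteratedConvexJoin_subset (s : Set E) (m : ℕ) :
    iteratedConvexJoin s m ⊆ convexHull ℝ s := by
  induction m with
  | zero => exact subset_convexHull ℝ s
  | succ m ih =>
    exact convexJoin_subset (subset_convexHull ℝ s) ih (convex_convexHull ℝ s)

lemma convexHull_finset_subset_iteratedConvexJoin (s : Set E) (m : ℕ) (t : Finset E)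
    (ht : ↑t ⊆ s) (hc : t.card = m + 1) : convexHull ℝ (t : Set E) ⊆ iteratedConvexJoin s m := by
  classical
  induction m generalizing t with
  | zero =>
    obtain ⟨a, rfl⟩ := Finset.card_eq_one.1 hc
    simpa [iteratedConvexJoin] using ht
  | succ m ih =>
    obtain ⟨a, u, hau, rfl, hu⟩ := Finset.card_eq_succ.1 hc
    rw [Finset.coe_insert, Set.insert_subset_iff] at ht
    have hne : (u : Set E).Nonempty := by
      rw [Finset.coe_nonempty, ← Finset.card_pos]; omega
    rw [Finset.coe_insert, convexHull_insert hne]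
    exact convexJoin_mono (Set.singleton_subset_iff.2 ht.1) (ih u ht.2 hu)

variable [TopologicalSpace E] [IsTopologicalAddGroup E] [ContinuousSMul ℝ E]

lemma isCompact_convexJoin {s t : Set E} (hs : IsCompact s) (ht : IsCompact t) :
    IsCompact (convexJoin ℝ s t) := by
  have h : convexJoin ℝ s t =
      (fun p : ℝ × E × E => (1 - p.1) • p.2.1 + p.1 • p.2.2) '' (Set.Icc 0 1 ×ˢ s ×ˢ t) := by
    ext z
    simp only [mem_convexJoin, segment_eq_image, Set.mem_image, Set.mem_prod, Prod.exists]
    constructor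
    · rintro ⟨a, ha, b, hb, θ, hθ, rfl⟩
      exact ⟨θ, a, b, ⟨hθ, ha, hb⟩, rfl⟩
    · rintro ⟨θ, a, b, ⟨hθ, ha, hb⟩, rfl⟩
      exact ⟨a, ha, b, hb, θ, hθ, rfl⟩
  rw [h]
  exact (isCompact_Icc.prod (hs.prod ht)).image (by fun_prop)

lemma isCompact_iteratedConvexJoin {s : Set E} (hs : IsCompact s) (m : ℕ) :
    IsCompact (iteratedConvexJoin s m) := by
  induction m with
  | zero => exact hs
  | succ m ih => exact isCompact_convexJoin hs ih

/-- By Carathéodory, dimension plus one points suffice, so the hull is a finite union of iterated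
joins, each compact. -/
lemma isCompact_convexHull [FiniteDimensional ℝ E] {s : Set E} (hs : IsCompact s) :
    IsCompact (convexHull ℝ s) := by
  have h : convexHull ℝ s =
      ⋃ m ∈ Finset.range (Module.finrank ℝ E + 1), iteratedConvexJoin s m := by
    apply Set.Subset.antisymm
    · rw [convexHull_eq_union]
      refine Set.iUnion_subset fun t => Set.iUnion_subset fun ht => Set.iUnion_subset fun hi => ?_
      rcases t.eq_empty_or_nonempty with rfl | hne
      · simp
      have hc := hi.card_le_finrank_succ
      have hf := Submodule.finrank_le (vectorSpan ℝ (Set.range ((↑) : t → E)))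
      rw [Fintype.card_coe] at hc
      have hp := hne.card_pos
      refine (convexHull_finset_subset_iteratedConvexJoin s (t.card - 1) t ht (by omega)).trans ?_
      refine Set.subset_biUnion_of_mem (u := fun m => iteratedConvexJoin s m) ?_
      simp only [Finset.coe_range]
      show t.card - 1 < _
      omega
    · exact Set.iUnion₂_subset fun m _ => iteratedConvexJoin_subset s m
  rw [h]
  exact (Finset.range _).isCompact_biUnion fun m _ => isCompact_iteratedConvexJoin hs m

end ConvexHull

/-! ### Index involution, monomials and phases -/

section Indices

variable {n : ℕ}

lemma bar_bar (i : Idx n) : bar (bar i) = i := by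
  funext k
  simp only [bar]
  generalize i k = b
  fin_cases b <;> rfl

lemma bar_ne [NeZero n] (i : Idx n) : bar i ≠ i := by
  intro h
  have := congrFun h 0
  simp only [bar] at this
  generalize i 0 = b at this
  fin_cases b <;> simp at this

lemma bar_injective : Function.Injective (bar : Idx n → Idx n) :=
  Function.LeftInverse.injective bar_bar

lemma bar_eq_iff {i j : Idx n} : bar i = j ↔ i = bar j :=
  ⟨fun h => by rw [← h, bar_bar], fun h => by rw [h, bar_bar]⟩

lemma sum_bar {M : Type*} [AddCommMonoid M] (f : Idx n → M) : ∑ i, f (bar i) = ∑ i, f i :=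
  Equiv.sum_comp (Function.Involutive.toPerm bar bar_bar) f

lemma monom_bar {K : Type*} [Field K] (z : Fin n → K) (i : Idx n) :
    monom z (bar i) = (monom z i)⁻¹ := by
  simp only [monom, ← Finset.prod_inv_distrib, ← zpow_neg]
  refine Finset.prod_congr rfl fun k _ => ?_
  simp only [bar]
  generalize i k = b
  fin_cases b <;> norm_num

lemma monom_mul {K : Type*} [Field K] (z w : Fin n → K) (i : Idx n) :
    monom (z * w) i = monom z i * monom w i := by
  simp [monom, mul_zpow, Finset.prod_mul_distrib]

lemma monom_one {K : Type*} [Field K] (i : Idx n) : monom (1 : Fin n → K) i = 1 := by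
  simp [monom]

lemma monom_pos {r : Fin n → ℝ} (hr : ∀ k, 0 < r k) (i : Idx n) : 0 < monom r i :=
  Finset.prod_pos fun k _ => zpow_pos (hr k) _

lemma norm_monom {α : Fin n → ℂ} (hα : ∀ k, ‖α k‖ = 1) (i : Idx n) : ‖monom α i‖ = 1 := by
  simp [monom, norm_prod, norm_zpow, hα]

lemma star_monom {α : Fin n → ℂ} (hα : ∀ k, ‖α k‖ = 1) (i : Idx n) :
    star (monom α i) = monom α (bar i) := by
  rw [monom_bar]
  exact (Complex.inv_eq_conj (norm_monom hα i)).symm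

lemma monom_mem_VSa {α : Fin n → ℂ} (hα : ∀ k, ‖α k‖ = 1) : monom α ∈ VSa n :=
  fun i => (star_monom hα i).symm

/-- Exponentiation carries the image of `Theta` to the monomial vectors of the torus. -/
lemma monom_eq_exp (x : Fin n → ℝ) (i : Idx n) :
    monom (fun k => Complex.exp (x k * Complex.I)) i =
      Complex.exp ((Theta n x i : ℂ) * Complex.I) := by
  simp only [monom, ← Complex.exp_int_mul, Theta, Matrix.mulVecLin_apply, Matrix.mulVec,
    dotProduct, Matrix.of_apply]
  rw [Complex.ofReal_sum, Finset.sum_mul, Complex.exp_sum]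
  refine Finset.prod_congr rfl fun k _ => ?_
  congr 1
  generalize i k = b
  fin_cases b <;> norm_num

lemma Theta_bar (x : Fin n → ℝ) (i : Idx n) : Theta n x (bar i) = - Theta n x i := by
  simp only [Theta, Matrix.mulVecLin_apply, Matrix.mulVec, dotProduct, Matrix.of_apply, bar,
    ← Finset.sum_neg_distrib]
  refine Finset.sum_congr rfl fun k _ => ?_
  rcases (by omega : i k = 0 ∨ i k = 1) with h | h <;> simp [h]

/-- Replaces angles, ambiguous modulo `2π`, by points of the torus; principal arguments of the
coordinates recover an angle vector. -/
lemma trivialPhaseDifference_iff {c : Idx n → ℂ} (hc : ∀ i, ‖c i‖ = 1) :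
    TrivialPhaseDifference c ↔ ∃ α : Fin n → ℂ, (∀ k, ‖α k‖ = 1) ∧ c = monom α := by
  constructor
  · rintro ⟨θ, ⟨-, h⟩, x, rfl⟩
    refine ⟨fun k => Complex.exp (x k * Complex.I), fun k => Complex.norm_exp_ofReal_mul_I _, ?_⟩
    funext i
    rw [monom_eq_exp, h i, hc i]
    simp
  · rintro ⟨α, hα, rfl⟩
    have h : α = fun k => Complex.exp ((α k).arg * Complex.I) := by
      funext k
      have := Complex.norm_mul_exp_arg_mul_I (α k)
      rw [hα k] at this
      simpa using this.symm
    refine ⟨Theta n fun k => (α k).arg, ⟨Theta_bar _, fun i => ?_⟩, _, rfl⟩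
    rw [norm_monom hα, ← monom_eq_exp, ← h]
    simp

end Indices

/-! ### The norms, their duals, and `Delta` -/

section Norms

variable {n : ℕ}

lemma re_sum_mul_le_sum_norm (u v : Idx n → ℂ) (hv : ∀ i, ‖v i‖ ≤ 1) :
    (∑ i, u i * v i).re ≤ ∑ i, ‖u i‖ := by
  refine (Complex.re_le_norm _).trans ((norm_sum_le _ _).trans (Finset.sum_le_sum fun i _ => ?_))
  rw [norm_mul]
  exact mul_le_of_le_one_right (norm_nonneg _) (hv i)

lemma le_xNorm (u : Idx n → ℂ) {α : Fin n → ℂ} (hα : ∀ k, ‖α k‖ = 1) :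
    (∑ i, u i * monom α i).re ≤ xNorm u := by
  refine le_csSup ⟨∑ i, ‖u i‖, ?_⟩ ⟨α, hα, rfl⟩
  rintro _ ⟨β, hβ, rfl⟩
  exact re_sum_mul_le_sum_norm u _ fun i => (norm_monom hβ i).le

lemma xNorm_le {u : Idx n → ℂ} {b : ℝ}
    (h : ∀ α : Fin n → ℂ, (∀ k, ‖α k‖ = 1) → (∑ i, u i * monom α i).re ≤ b) : xNorm u ≤ b := by
  refine csSup_le ⟨_, 1, by simp, rfl⟩ ?_
  rintro _ ⟨α, hα, rfl⟩
  exact h α hα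

/-- All exponents are `±1`, hence odd, so one sign change negates every monomial. This makes the
supremum in `xNorm` bound absolute values. -/
lemma monom_update_neg [NeZero n] (α : Fin n → ℂ) (i : Idx n) :
    monom (Function.update (1 : Fin n → ℂ) 0 (-1) * α) i = - monom α i := by
  rw [monom_mul, monom, Finset.prod_eq_single 0]
  · simp only [Function.update_self]
    generalize i 0 = b
    fin_cases b <;> norm_num
  · intro k _ hk
    simp [Function.update_of_ne hk]
  · simp

lemma abs_le_xNorm [NeZero n] (u : Idx n → ℂ) {α : Fin n → ℂ} (hα : ∀ k, ‖α k‖ = 1) :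
    |(∑ i, u i * monom α i).re| ≤ xNorm u := by
  refine abs_le.2 ⟨?_, le_xNorm u hα⟩
  have h := le_xNorm u (α := Function.update (1 : Fin n → ℂ) 0 (-1) * α) fun k => by
    by_cases hk : k = 0
    · subst hk; simp [hα]
    · simp [Function.update_of_ne hk, hα]
  simp only [monom_update_neg, mul_neg, Finset.sum_neg_distrib, Complex.neg_re] at h
  linarith

lemma xNorm_nonneg [NeZero n] (u : Idx n → ℂ) : 0 ≤ xNorm u :=
  (abs_nonneg _).trans (abs_le_xNorm u (α := 1) (by simp))

lemma im_pairing_eq_zero {u v : Idx n → ℂ} (hu : u ∈ VSa n) (hv : v ∈ VSa n) :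
    (∑ i, u i * v i).im = 0 := by
  rw [← Complex.conj_eq_iff_im, map_sum, ← sum_bar fun i => u i * v i]
  refine Finset.sum_congr rfl fun i _ => ?_
  rw [hu i, hv i, map_mul]
  rfl

/-- The points of the torus with coordinates in `{1, i}`, which separate the monomials. -/
def gridPoint (m : Idx n) : Fin n → ℂ := fun k => if m k = 0 then 1 else Complex.I

lemma norm_gridPoint (m : Idx n) (k : Fin n) : ‖gridPoint m k‖ = 1 := by
  unfold gridPoint; split_ifs <;> simp

/-- The sum factors over the qubits: a factor is `1 + 1` where the digits agree and `1 + I ^ (±2) =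
0` where they differ. -/
lemma sum_monom_gridPoint (i j : Idx n) :
    ∑ m : Idx n, monom (gridPoint m) j * monom (gridPoint m) (bar i) =
      if i = j then 2 ^ n else 0 := by
  have h : ∀ m : Idx n, monom (gridPoint m) j * monom (gridPoint m) (bar i) =
      ∏ k, ((if m k = 0 then (1 : ℂ) else Complex.I) ^ ((1 : ℤ) - 2 * (((j k : Fin 2) : ℕ) : ℤ)) *
        (if m k = 0 then (1 : ℂ) else Complex.I) ^
          ((1 : ℤ) - 2 * (((bar i k : Fin 2) : ℕ) : ℤ))) := fun m => by
    rw [Finset.prod_mul_distrib]; rfl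
  simp only [h]
  have hs := Finset.prod_univ_sum (R := ℂ) (fun _ : Fin n => (Finset.univ : Finset (Fin 2)))
    (fun k b => (if b = 0 then (1 : ℂ) else Complex.I) ^ ((1 : ℤ) - 2 * (((j k : Fin 2) : ℕ) : ℤ)) *
        (if b = 0 then (1 : ℂ) else Complex.I) ^
          ((1 : ℤ) - 2 * (((bar i k : Fin 2) : ℕ) : ℤ)))
  rw [Fintype.piFinset_univ] at hs
  rw [← hs]
  have hk : ∀ k, ∑ b : Fin 2, ((if b = 0 then (1 : ℂ) else Complex.I) ^
        ((1 : ℤ) - 2 * (((j k : Fin 2) : ℕ) : ℤ)) *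
      (if b = 0 then (1 : ℂ) else Complex.I) ^ ((1 : ℤ) - 2 * (((bar i k : Fin 2) : ℕ) : ℤ))) =
      if i k = j k then 2 else 0 := fun k => by
    rw [Fin.sum_univ_two]
    simp only [bar]
    rcases (by omega : i k = 0 ∨ i k = 1) with h | h <;>
    rcases (by omega : j k = 0 ∨ j k = 1) with h' | h' <;> norm_num [h, h']
  simp only [hk]
  split_ifs with hij
  · simp [hij]
  · obtain ⟨k, hk⟩ := Function.ne_iff.1 hij
    exact Finset.prod_eq_zero (Finset.mem_univ k) (if_neg hk)

/-- Orthogonality on the grid writes `u i` as an average of `2 ^ n` terms of modulus at most `xNorm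
u`. Consequently `xNorm` is definite on `VSa n` and the supremum defining `xDualNorm` is finite. -/
lemma norm_apply_le_xNorm [NeZero n] {u : Idx n → ℂ} (hu : u ∈ VSa n) (i : Idx n) :
    ‖u i‖ ≤ xNorm u := by
  have h : ∑ m : Idx n, (∑ j, u j * monom (gridPoint m) j) * monom (gridPoint m) (bar i) =
      2 ^ n * u i := by
    simp only [Finset.sum_mul, mul_assoc]
    rw [Finset.sum_comm]
    simp only [← Finset.mul_sum, sum_monom_gridPoint]
    simp [mul_comm]
  have h2 : ‖(2 : ℂ) ^ n * u i‖ ≤ 2 ^ n * xNorm u := by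
    rw [← h]
    refine (norm_sum_le _ _).trans ((Finset.sum_le_card_nsmul _ _ (xNorm u) fun m _ => ?_).trans ?_)
    · rw [norm_mul, norm_monom (norm_gridPoint m), mul_one]
      have him := im_pairing_eq_zero hu (monom_mem_VSa (norm_gridPoint m))
      rw [← Complex.re_add_im (∑ j, u j * monom (gridPoint m) j), him]
      rw [Complex.ofReal_zero, zero_mul, add_zero, Complex.norm_real]
      exact abs_le_xNorm u (norm_gridPoint m)
    · simp
  rw [norm_mul, norm_pow, Complex.norm_ofNat] at h2
  exact le_of_mul_le_mul_left h2 (by positivity)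

lemma re_pairing_smul (r : ℝ) (u v : Idx n → ℂ) :
    (∑ i, (r • u) i * v i).re = r * (∑ i, u i * v i).re := by
  simp only [Pi.smul_apply, smul_mul_assoc, ← Finset.smul_sum, Complex.smul_re, smul_eq_mul]

lemma xNorm_smul {r : ℝ} (hr : 0 < r) (u : Idx n → ℂ) : xNorm (r • u) = r * xNorm u := by
  have key : ∀ {r : ℝ}, 0 < r → ∀ u : Idx n → ℂ, xNorm (r • u) ≤ r * xNorm u :=
    fun {r} hr u => xNorm_le fun α hα => by
      rw [re_pairing_smul]
      exact mul_le_mul_of_nonneg_left (le_xNorm u hα) hr.le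
  refine le_antisymm (key hr u) ?_
  have h := key (inv_pos.2 hr) (r • u)
  rw [smul_smul, inv_mul_cancel₀ hr.ne', one_smul] at h
  rwa [inv_mul_eq_div, le_div_iff₀ hr, mul_comm] at h

lemma smul_mem_VSa (r : ℝ) {u : Idx n → ℂ} (hu : u ∈ VSa n) : r • u ∈ VSa n := fun i => by
  simp [hu i]

lemma normalize_mem_VSa {u : Idx n → ℂ} (hu : u ∈ VSa n) (h : 0 < xNorm u) :
    (xNorm u)⁻¹ • u ∈ VSa n ∧ xNorm ((xNorm u)⁻¹ • u) = 1 :=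
  ⟨smul_mem_VSa _ hu, by rw [xNorm_smul (inv_pos.2 h), inv_mul_cancel₀ h.ne']⟩

lemma exists_xNorm_eq_one [NeZero n] : ∃ u ∈ VSa n, xNorm u = 1 := by
  have h1 : (1 : Idx n → ℂ) ∈ VSa n := fun i => by simp
  have h : 0 < xNorm (1 : Idx n → ℂ) :=
    zero_lt_one.trans_le (by simpa using norm_apply_le_xNorm h1 0)
  exact ⟨_, normalize_mem_VSa h1 h⟩

lemma re_pairing_le_sum [NeZero n] {u : Idx n → ℂ} (hu : u ∈ VSa n) (h1 : xNorm u = 1)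
    (c : Idx n → ℂ) : (∑ i, u i * c i).re ≤ ∑ i, ‖c i‖ := by
  simp only [mul_comm (u _)]
  exact re_sum_mul_le_sum_norm c u fun i => h1 ▸ norm_apply_le_xNorm hu i

lemma re_pairing_le_xDualNorm [NeZero n] {u : Idx n → ℂ} (hu : u ∈ VSa n) (h1 : xNorm u = 1)
    (c : Idx n → ℂ) : (∑ i, u i * c i).re ≤ xDualNorm c := by
  refine le_csSup ⟨∑ i, ‖c i‖, ?_⟩ ⟨u, hu, h1, rfl⟩
  rintro _ ⟨v, hv, hv1, rfl⟩
  exact re_pairing_le_sum hv hv1 c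

lemma re_pairing_le_mul [NeZero n] {u : Idx n → ℂ} (hu : u ∈ VSa n) (c : Idx n → ℂ) :
    (∑ i, u i * c i).re ≤ xNorm u * xDualNorm c := by
  rcases (xNorm_nonneg u).eq_or_lt with h | h
  · have h0 : u = 0 := funext fun i => by simpa [← h] using norm_apply_le_xNorm hu i
    rw [← h, h0]
    simp
  · have := normalize_mem_VSa hu h
    have h2 := re_pairing_le_xDualNorm this.1 this.2 c
    rwa [re_pairing_smul, inv_mul_eq_div, div_le_iff₀ h, mul_comm] at h2

lemma xDualNorm_smul {t : ℝ} (ht : 0 ≤ t) (c : Idx n → ℂ) :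
    xDualNorm (t • c) = t * xDualNorm c := by
  rw [xDualNorm, xDualNorm, ← smul_eq_mul, ← Real.sSup_smul_of_nonneg ht]
  congr 1
  ext x
  simp only [Set.mem_smul_set, Set.mem_ofPred_eq]
  have h : ∀ u : Idx n → ℂ, (∑ i, u i * (t • c) i).re = t • (∑ i, u i * c i).re := fun u => by
    simp only [mul_comm (u _), re_pairing_smul, smul_eq_mul]
  constructor
  · rintro ⟨u, hu, h1, rfl⟩
    exact ⟨_, ⟨u, hu, h1, rfl⟩, (h u).symm⟩
  · rintro ⟨_, ⟨u, hu, h1, rfl⟩, rfl⟩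
    exact ⟨u, hu, h1, (h u).symm⟩

lemma delta_le {s : Idx n → ℝ} (hs : s ∈ VPos n) {r : Fin n → ℝ} (hr : ∀ k, 0 < r k) :
    delta s ≤ ∑ i, s i * monom r i := by
  refine csInf_le ⟨0, ?_⟩ ⟨r, hr, rfl⟩
  rintro _ ⟨q, hq, rfl⟩
  exact Finset.sum_nonneg fun i _ => mul_nonneg (hs i) (monom_pos hq i).le

/-- Values at `i` and `bar i` are inverse to each other, and `x + x⁻¹ ≥ 2`. -/
lemma card_le_sum_monom {r : Fin n → ℝ} (hr : ∀ k, 0 < r k) :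
    (2 : ℝ) ^ n ≤ ∑ i, monom r i := by
  have h : ∀ i : Idx n, (2 : ℝ) ≤ monom r i + monom r (bar i) := fun i => by
    rw [monom_bar]
    have hp := monom_pos hr i
    have h1 := mul_inv_cancel₀ hp.ne'
    nlinarith [sq_nonneg (monom r i - (monom r i)⁻¹), inv_pos.2 hp]
  have h2 := Finset.sum_le_sum fun i (_ : i ∈ Finset.univ) => h i
  rw [Finset.sum_add_distrib, sum_bar] at h2
  simp at h2
  linarith

/-- The uniform distribution. -/
noncomputable def uniform (n : ℕ) : Idx n → ℝ := fun _ => ((2 : ℝ) ^ n)⁻¹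

lemma uniform_mem_VPos : uniform n ∈ VPos n := fun _ => by unfold uniform; positivity

lemma sum_uniform : ∑ i : Idx n, uniform n i = 1 := by
  simp [uniform]

lemma delta_uniform : delta (uniform n) = 1 := by
  refine le_antisymm ?_ ?_
  · have h := delta_le (uniform_mem_VPos (n := n)) (r := 1) (by simp)
    simpa only [monom_one, mul_one, sum_uniform] using h
  · refine le_csInf ⟨_, 1, by simp, rfl⟩ ?_
    rintro _ ⟨r, hr, rfl⟩
    simp only [uniform]
    rw [← Finset.mul_sum, inv_mul_eq_div, le_div_iff₀ (by positivity), one_mul]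
    exact card_le_sum_monom hr

lemma Delta_one : Delta (1 : Idx n → ℝ) = 1 := by
  have h : ∀ x ∈ {x | ∃ s ∈ VPos n, delta s = 1 ∧ x = ∑ i, s i * (1 : Idx n → ℝ) i}, 1 ≤ x := by
    rintro _ ⟨s, hs, h1, rfl⟩
    have := delta_le hs (r := 1) (by simp)
    simpa only [monom_one, h1, Pi.one_apply] using this
  refine le_antisymm ?_ (le_csInf ⟨_, uniform n, uniform_mem_VPos, delta_uniform, rfl⟩ h)
  exact csInf_le ⟨1, h⟩ ⟨uniform n, uniform_mem_VPos, delta_uniform, by simp [sum_uniform]⟩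

lemma Delta_smul {t : ℝ} (ht : 0 ≤ t) (a : Idx n → ℝ) : Delta (t • a) = t * Delta a := by
  rw [Delta, Delta, ← smul_eq_mul, ← Real.sInf_smul_of_nonneg ht]
  congr 1
  ext x
  simp only [Set.mem_smul_set, Set.mem_ofPred_eq]
  have h : ∀ s : Idx n → ℝ, ∑ i, s i * (t • a) i = t • ∑ i, s i * a i := fun s => by
    simp only [Pi.smul_apply, mul_smul_comm, Finset.smul_sum]
  constructor
  · rintro ⟨u, hu, h1, rfl⟩
    exact ⟨_, ⟨u, hu, h1, rfl⟩, (h u).symm⟩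
  · rintro ⟨_, ⟨u, hu, h1, rfl⟩, rfl⟩
    exact ⟨u, hu, h1, (h u).symm⟩

/-- Turns the criterion into linear inequalities in `(a, c)`. Nonnegativity of `a` bounds the set
under the infimum below, so that `sInf` is not a default value. -/
lemma xDualNorm_le_Delta_iff [NeZero n] {a : Idx n → ℝ} (ha : ∀ i, 0 ≤ a i) (c : Idx n → ℂ) :
    xDualNorm c ≤ Delta a ↔ ∀ s ∈ VPos n, delta s = 1 → ∀ u ∈ VSa n, xNorm u = 1 →
      (∑ i, u i * c i).re ≤ ∑ i, s i * a i := by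
  constructor
  · intro h s hs hs1 u hu hu1
    refine (re_pairing_le_xDualNorm hu hu1 c).trans (h.trans (csInf_le ⟨0, ?_⟩ ⟨s, hs, hs1, rfl⟩))
    rintro _ ⟨q, hq, -, rfl⟩
    exact Finset.sum_nonneg fun i _ => mul_nonneg (hq i) (ha i)
  · intro h
    -- Both families must be nonempty, since `sSup` and `sInf` of the empty set are `0`.
    obtain ⟨u₀, hu₀, hu₀1⟩ := exists_xNorm_eq_one (n := n)
    refine csSup_le ⟨_, u₀, hu₀, hu₀1, rfl⟩ ?_
    rintro _ ⟨u, hu, hu1, rfl⟩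
    refine le_csInf ⟨_, uniform n, uniform_mem_VPos, delta_uniform, rfl⟩ ?_
    rintro _ ⟨s, hs, hs1, rfl⟩
    exact h s hs hs1 u hu hu1

end Norms

/-! ### Dual norm of unimodular vectors -/

section UnimodularPhases

variable {n : ℕ} {c : Idx n → ℂ}

lemma star_mem_VSa (hc : c ∈ VSa n) : star c ∈ VSa n := fun i => by
  simp [hc i]

lemma re_pairing_star (hc1 : ∀ i, ‖c i‖ = 1) : (∑ i, (star c) i * c i).re = 2 ^ n := by
  have h : ∀ i, (star c) i * c i = 1 := fun i => by
    simpa [hc1 i] using Complex.conj_mul' (c i)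
  simp only [h]
  simp [← Complex.ofReal_ofNat, ← Complex.ofReal_pow]

lemma sum_norm_star (hc1 : ∀ i, ‖c i‖ = 1) : ∑ i, ‖(star c) i‖ = 2 ^ n := by
  simp [hc1]

lemma xNorm_star_le (hc1 : ∀ i, ‖c i‖ = 1) : xNorm (star c) ≤ 2 ^ n :=
  xNorm_le fun _ hα => (re_sum_mul_le_sum_norm _ _ fun i => (norm_monom hα i).le).trans_eq
    (sum_norm_star hc1)

lemma eq_one_of_re_eq_one {z : ℂ} (hz : ‖z‖ = 1) (h : z.re = 1) : z = 1 := by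
  have h2 := Complex.sq_norm z
  rw [hz, Complex.normSq_apply, h] at h2
  exact Complex.ext h (by nlinarith : z.im = 0)

lemma exists_xNorm_eq (u : Idx n → ℂ) :
    ∃ α : Fin n → ℂ, (∀ k, ‖α k‖ = 1) ∧ (∑ i, u i * monom α i).re = xNorm u := by
  have hK : IsCompact {α : Fin n → ℂ | ∀ k, α k ∈ Metric.sphere (0 : ℂ) 1} :=
    isCompact_pi_infinite fun _ => isCompact_sphere 0 1
  have hcont : ContinuousOn (fun α : Fin n → ℂ => (∑ i, u i * monom α i).re)
      {α : Fin n → ℂ | ∀ k, α k ∈ Metric.sphere (0 : ℂ) 1} := by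
    refine Complex.continuous_re.comp_continuousOn (continuousOn_finsetSum _ fun i _ =>
      continuousOn_const.mul (continuousOn_finsetProd _ fun k _ => ?_))
    refine (continuous_apply k).continuousOn.zpow₀ _ fun _ hα => Or.inl fun h => ?_
    have := hα k
    simp only [mem_sphere_zero_iff_norm] at this
    simp [h] at this
  obtain ⟨α, hα, hmax⟩ := hK.exists_isMaxOn ⟨1, fun k => by simp⟩ hcont
  have hα' : ∀ k, ‖α k‖ = 1 := fun k => by simpa using hα k
  refine ⟨α, hα', le_antisymm (le_xNorm u hα') (xNorm_le fun β hβ => ?_)⟩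
  exact hmax (show β ∈ {α : Fin n → ℂ | ∀ k, α k ∈ Metric.sphere (0 : ℂ) 1} from
    fun k => by simpa using hβ k)

/-- The supremum is attained at some `α`. If it were `2 ^ n`, each of the `2 ^ n` unimodular terms
would have real part `1`, hence equal `1`, giving `c = monom α`. -/
lemma xNorm_star_lt (hc1 : ∀ i, ‖c i‖ = 1) (hne : ¬ TrivialPhaseDifference c) :
    xNorm (star c) < 2 ^ n := by
  obtain ⟨α, hα, h⟩ := exists_xNorm_eq (star c)
  refine lt_of_le_of_ne (xNorm_star_le hc1) fun heq => hne ?_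
  rw [trivialPhaseDifference_iff hc1]
  refine ⟨α, hα, funext fun i => ?_⟩
  have hn : ∀ i, ‖(star c) i * monom α i‖ = 1 := fun i => by simp [hc1, norm_monom hα]
  have hle : ∀ i ∈ Finset.univ, ((star c) i * monom α i).re ≤ 1 := fun i _ =>
    (Complex.re_le_norm _).trans_eq (hn i)
  have hs : ∑ i, ((star c) i * monom α i).re = ∑ _i : Idx n, (1 : ℝ) := by
    rw [← Complex.re_sum, h, heq]
    simp
  have h1 := eq_one_of_re_eq_one (hn i) ((Finset.sum_eq_sum_iff_of_le hle).1 hs i (Finset.mem_univ i))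
  have h2 : c i * (star c) i = 1 := by simpa [hc1 i] using Complex.mul_conj' (c i)
  rw [← mul_one (c i), ← h1, ← mul_assoc, h2, one_mul]

lemma two_pow_le_xNorm_star_mul_xDualNorm [NeZero n] (hc : c ∈ VSa n) (hc1 : ∀ i, ‖c i‖ = 1) :
    (2 : ℝ) ^ n ≤ xNorm (star c) * xDualNorm c :=
  (re_pairing_star hc1).symm.trans_le (re_pairing_le_mul (star_mem_VSa hc) c)

lemma xDualNorm_pos [NeZero n] (hc : c ∈ VSa n) (hc1 : ∀ i, ‖c i‖ = 1) : 0 < xDualNorm c := by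
  have h := two_pow_le_xNorm_star_mul_xDualNorm hc hc1
  have h2 : (0 : ℝ) < 2 ^ n := by positivity
  exact pos_of_mul_pos_right (h2.trans_le h) (xNorm_nonneg _)

lemma one_lt_xDualNorm [NeZero n] (hc : c ∈ VSa n) (hc1 : ∀ i, ‖c i‖ = 1)
    (hne : ¬ TrivialPhaseDifference c) : 1 < xDualNorm c := by
  have h := two_pow_le_xNorm_star_mul_xDualNorm hc hc1
  have h2 : (0 : ℝ) < 2 ^ n := by positivity
  have h3 := mul_lt_mul_of_pos_right (xNorm_star_lt hc1 hne) (xDualNorm_pos hc hc1)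
  exact lt_of_mul_lt_mul_left (by simpa using h.trans_lt h3) h2.le

/-- The bipolar theorem for the dual norm: its unit ball is the convex hull of the monomial
vectors. -/
lemma mem_convexHull_of_xDualNorm_le_one [NeZero n] (hc : c ∈ VSa n) (h : xDualNorm c ≤ 1) :
    c ∈ convexHull ℝ {v : Idx n → ℂ | ∃ α : Fin n → ℂ, (∀ k, ‖α k‖ = 1) ∧ v = monom α} := by
  by_contra hcon
  have hK : IsCompact {v : Idx n → ℂ | ∃ α : Fin n → ℂ, (∀ k, ‖α k‖ = 1) ∧ v = monom α} := by
    have hT : IsCompact {α : Fin n → ℂ | ∀ k, α k ∈ Metric.sphere (0 : ℂ) 1} :=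
      isCompact_pi_infinite fun _ => isCompact_sphere 0 1
    have hcont : ContinuousOn (monom : (Fin n → ℂ) → Idx n → ℂ)
        {α : Fin n → ℂ | ∀ k, α k ∈ Metric.sphere (0 : ℂ) 1} := by
      refine continuousOn_pi.2 fun i => continuousOn_finsetProd _ fun k _ => ?_
      refine (continuous_apply k).continuousOn.zpow₀ _ fun _ hα => Or.inl fun h => ?_
      have := hα k
      simp only [mem_sphere_zero_iff_norm] at this
      simp [h] at this
    convert hT.image_of_continuousOn hcont using 1
    ext v
    simp only [Set.mem_ofPred_eq, Set.mem_image, mem_sphere_zero_iff_norm]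
    exact exists_congr fun α => and_congr_right fun _ => eq_comm
  obtain ⟨f, b, hf, hb⟩ := RCLike.geometric_hahn_banach_closed_point (𝕜 := ℂ)
    (convex_convexHull ℝ _) (isCompact_convexHull hK).isClosed hcon
  set w : Idx n → ℂ := fun i => f fun j => if i = j then 1 else 0 with hw
  have hfw : ∀ v, f v = ∑ i, w i * v i := fun v => by
    have := f.toLinearMap.pi_apply_eq_sum_univ v
    simp only [smul_eq_mul] at this
    simp only [mul_comm (w _)]
    exact this
  -- The self-adjoint part of the separating functional has the same real part on `VSa n`, which
  -- contains `c` and all monomial vectors.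
  set u : Idx n → ℂ := fun i => (w i + star (w (bar i))) / 2 with hu
  have huV : u ∈ VSa n := fun i => by
    simp [hu, bar_bar, add_comm]
  have hre : ∀ v ∈ VSa n, (f v).re = (∑ i, u i * v i).re := fun v hv => by
    have h2 : (∑ i, star (w (bar i)) * v i).re = (∑ i, w i * v i).re := by
      rw [← sum_bar, ← Complex.conj_re, map_sum]
      congr 1
      refine Finset.sum_congr rfl fun i _ => ?_
      rw [bar_bar, hv i]
      simp
    rw [hfw]
    simp only [hu, div_mul_eq_mul_div, add_mul]
    rw [← Finset.sum_div, Finset.sum_add_distrib]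
    have : ((∑ i, w i * v i + ∑ i, star (w (bar i)) * v i) / 2).re =
      ((∑ i, w i * v i).re + (∑ i, star (w (bar i)) * v i).re) / 2 := by simp
    rw [this, h2]
    ring
  have h1 : xNorm u ≤ b := xNorm_le fun α hα => by
    rw [← hre _ (monom_mem_VSa hα)]
    exact (hf _ (subset_convexHull ℝ _ ⟨α, hα, rfl⟩)).le
  have h2 := re_pairing_le_mul huV c
  have h3 : b < (∑ i, u i * c i).re := by rw [← hre c hc]; exact hb
  have h4 := mul_le_mul_of_nonneg_left h (xNorm_nonneg u)
  linarith

end UnimodularPhases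

/-! ### Positivity of X-matrices and their partial transposes -/

section QuadraticForms

variable {n : ℕ}

/-- The real part of the quadratic form of `M`. -/
noncomputable def quad (M : QMat n) (x : Idx n → ℂ) : ℝ := (star x ⬝ᵥ M.mulVec x).re

lemma quad_sub (M N : QMat n) (x : Idx n → ℂ) : quad (M - N) x = quad M x - quad N x := by
  simp [quad, Matrix.sub_mulVec, dotProduct_sub]

lemma quad_smul (r : ℝ) (M : QMat n) (x : Idx n → ℂ) : quad (r • M) x = r * quad M x := by
  simp [quad, Matrix.smul_mulVec, dotProduct_smul]

lemma posSemidef_of_quad {M : QMat n} (hM : M.IsHermitian) (h : ∀ x, 0 ≤ quad M x) :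
    M.PosSemidef :=
  .of_dotProduct_mulVec_nonneg hM fun x =>
    Complex.nonneg_iff.2 ⟨h x, (hM.im_star_dotProduct_mulVec_self x).symm⟩

lemma posDef_of_quad {M : QMat n} (hM : M.IsHermitian) (h : ∀ x, x ≠ 0 → 0 < quad M x) :
    M.PosDef :=
  .of_dotProduct_mulVec_pos hM fun x hx =>
    Complex.pos_iff.2 ⟨h x hx, (hM.im_star_dotProduct_mulVec_self x).symm⟩

lemma abs_quad_le {M : QMat n} {ε : ℝ} (h : ∀ i j, ‖M i j‖ ≤ ε) (x : Idx n → ℂ) :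
    |quad M x| ≤ ε * 2 ^ n * ∑ i, ‖x i‖ ^ 2 := by
  have hε : 0 ≤ ε := (norm_nonneg _).trans (h 0 0)
  calc |quad M x| ≤ ‖star x ⬝ᵥ M.mulVec x‖ := Complex.abs_re_le_norm _
    _ ≤ ∑ i, ‖x i‖ * ∑ j, ε * ‖x j‖ := by
      refine (norm_sum_le _ _).trans (Finset.sum_le_sum fun i _ => ?_)
      rw [norm_mul, Pi.star_apply, norm_star]
      refine mul_le_mul_of_nonneg_left ?_ (norm_nonneg _)
      refine (norm_sum_le _ _).trans (Finset.sum_le_sum fun j _ => ?_)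
      rw [norm_mul]
      exact mul_le_mul_of_nonneg_right (h i j) (norm_nonneg _)
    _ = ε * (∑ i, ‖x i‖) ^ 2 := by
      rw [← Finset.mul_sum, ← Finset.sum_mul]; ring
    _ ≤ ε * (2 ^ n * ∑ i, ‖x i‖ ^ 2) := by
      refine mul_le_mul_of_nonneg_left ?_ hε
      have := sq_sum_le_card_mul_sum_sq (s := (Finset.univ : Finset (Idx n))) (f := fun i => ‖x i‖)
      simpa using this
    _ = _ := by ring

/-- A uniform lower bound on the form absorbs a small entrywise perturbation. Since partial
transposition permutes entries, one `ε` serves all partial transposes. -/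
lemma posSemidef_of_near {M N : QMat n} {m ε : ℝ} (hM : ∀ x, m * ∑ i, ‖x i‖ ^ 2 ≤ quad M x)
    (hN : N.IsHermitian) (hε : ε * 2 ^ n ≤ m) (h : ∀ i j, ‖N i j - M i j‖ ≤ ε) :
    N.PosSemidef := by
  refine posSemidef_of_quad hN fun x => ?_
  have h1 := abs_quad_le (M := N - M) h x
  rw [quad_sub] at h1
  have h2 := hM x
  have h3 := (abs_le.1 h1).1
  have h4 : ε * 2 ^ n * ∑ i, ‖x i‖ ^ 2 ≤ m * ∑ i, ‖x i‖ ^ 2 :=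
    mul_le_mul_of_nonneg_right hε (Finset.sum_nonneg fun i _ => by positivity)
  linarith

lemma isHermitian_partialTranspose {M : QMat n} (hM : M.IsHermitian) (S : Finset (Fin n)) :
    (partialTranspose S M).IsHermitian :=
  Matrix.IsHermitian.ext fun i j => hM.apply (fun k => if k ∈ S then j k else i k)
    (fun k => if k ∈ S then i k else j k)

lemma partialTranspose_empty (M : QMat n) : partialTranspose ∅ M = M := by
  ext i j
  simp [partialTranspose]

lemma trace_smul_X (r : ℝ) (v : Idx n → ℂ) : (r • X 1 v).trace = r * 2 ^ n := by
  simp [Matrix.trace, X, mul_comm]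

lemma isHermitian_X [NeZero n] (s : Idx n → ℝ) {v : Idx n → ℂ} (hv : v ∈ VSa n) :
    (X s v).IsHermitian := by
  refine Matrix.IsHermitian.ext fun i j => ?_
  simp only [X, Matrix.of_apply]
  by_cases h : i = j
  · subst h; simp
  rw [if_neg h, if_neg (Ne.symm h)]
  by_cases h' : i = bar j
  · subst h'
    simp [bar_bar, hv j]
  · rw [if_neg h', if_neg fun h2 => h' (by rw [h2, bar_bar])]
    simp

lemma mulVec_X [NeZero n] (s : Idx n → ℝ) (v x : Idx n → ℂ) (i : Idx n) :
    (X s v).mulVec x i = s i * x i + v i * x (bar i) := by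
  simp only [Matrix.mulVec, dotProduct, X, Matrix.of_apply]
  have h : ∀ j, (if j = i then (s i : ℂ) else if j = bar i then v i else 0) * x j =
      (if j = i then (s i : ℂ) * x j else 0) + (if j = bar i then v i * x j else 0) := fun j => by
    by_cases h1 : j = i
    · subst h1; simp [(bar_ne j).symm]
    · simp only [if_neg h1, zero_add, ite_mul, zero_mul]
  simp only [h, Finset.sum_add_distrib, Finset.sum_ite_eq', Finset.mem_univ, if_true]

lemma le_quad_X [NeZero n] {v : Idx n → ℂ} {τ : ℝ} (hv : ∀ i, ‖v i‖ ≤ τ) (x : Idx n → ℂ) :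
    (1 - τ) * ∑ i, ‖x i‖ ^ 2 ≤ quad (X 1 v) x := by
  have h1 : quad (X 1 v) x = ∑ i, ‖x i‖ ^ 2 + (∑ i, star (x i) * (v i * x (bar i))).re := by
    simp only [quad, dotProduct, mulVec_X, Pi.star_apply, mul_add, Finset.sum_add_distrib,
      Complex.add_re]
    congr 1
    rw [Complex.re_sum]
    refine Finset.sum_congr rfl fun i _ => ?_
    have : star (x i) * x i = ((‖x i‖ ^ 2 : ℝ) : ℂ) := by
      simpa using Complex.conj_mul' (x i)
    simp only [Pi.one_apply, Complex.ofReal_one, one_mul, this, Complex.ofReal_re]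
  have h2 : |(∑ i, star (x i) * (v i * x (bar i))).re| ≤ τ * ∑ i, ‖x i‖ ^ 2 := by
    calc _ ≤ ∑ i, ‖star (x i) * (v i * x (bar i))‖ :=
          (Complex.abs_re_le_norm _).trans (norm_sum_le _ _)
      _ ≤ ∑ i, τ * ((‖x i‖ ^ 2 + ‖x (bar i)‖ ^ 2) / 2) := by
          refine Finset.sum_le_sum fun i _ => ?_
          have hτ : 0 ≤ τ := (norm_nonneg _).trans (hv i)
          rw [norm_mul, norm_mul, norm_star]
          calc ‖x i‖ * (‖v i‖ * ‖x (bar i)‖) = ‖v i‖ * (‖x i‖ * ‖x (bar i)‖) := by ring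
            _ ≤ τ * (‖x i‖ * ‖x (bar i)‖) := by gcongr; exact hv i
            _ ≤ _ := by
              refine mul_le_mul_of_nonneg_left ?_ hτ
              nlinarith [sq_nonneg (‖x i‖ - ‖x (bar i)‖)]
      _ = _ := by
          rw [← Finset.mul_sum, ← Finset.sum_div, Finset.sum_add_distrib,
            sum_bar fun i => ‖x i‖ ^ 2]
          ring
  have h3 := (abs_le.1 h2).1
  rw [h1]
  linarith

/-- Swapping the digits in `S` preserves both relations `j = i` and `j = bar i`, so the X-shape
survives with permuted anti-diagonal. -/
lemma partialTranspose_smul_X (S : Finset (Fin n)) (r : ℝ) (v : Idx n → ℂ) :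
    partialTranspose S (r • X 1 v) =
      r • X 1 fun i => v fun k => if k ∈ S then bar i k else i k := by
  ext i j
  simp only [partialTranspose, X, Matrix.of_apply, Matrix.smul_apply]
  have h1 : ((fun k => if k ∈ S then i k else j k) = fun k => if k ∈ S then j k else i k) ↔
      j = i := by
    refine ⟨fun h => funext fun k => ?_, fun h => by rw [h]⟩
    have := congrFun h k
    by_cases hk : k ∈ S
    · simpa [hk] using this.symm
    · simpa [hk] using this
  have h2 : ((fun k => if k ∈ S then i k else j k) =
      bar fun k => if k ∈ S then j k else i k) ↔ j = bar i := by
    refine ⟨fun h => funext fun k => ?_, fun h => ?_⟩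
    · have := congrFun h k
      by_cases hk : k ∈ S
      · simp only [bar, if_pos hk] at this ⊢
        omega
      · simpa [bar, hk] using this
    · subst h
      funext k
      by_cases hk : k ∈ S
      · have := congrFun (bar_bar i) k
        simpa [bar, hk] using this.symm
      · simp [bar, hk]
  simp only [h1, h2]
  by_cases hji : j = i
  · simp [hji]
  · by_cases hb : j = bar i
    · subst hb; simp [hji]
    · simp [hji, hb]

end QuadraticForms

/-! ### The family `rho c t`: positivity, rank, interior and boundary -/

section Families

variable {n : ℕ} {c : Idx n → ℂ}

lemma trace_rho (c : Idx n → ℂ) (t : ℝ) : (rho c t).trace = 1 := by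
  rw [rho, trace_smul_X]
  simp

lemma isHermitian_rho [NeZero n] (hc : c ∈ VSa n) (t : ℝ) : (rho c t).IsHermitian :=
  (isHermitian_X 1 (smul_mem_VSa t hc)).smul (IsSelfAdjoint.all _)

lemma le_quad_partialTranspose_rho [NeZero n] (hc1 : ∀ i, ‖c i‖ = 1) {t : ℝ} (ht : 0 ≤ t)
    (S : Finset (Fin n)) (x : Idx n → ℂ) :
    ((2 : ℝ) ^ n)⁻¹ * (1 - t) * ∑ i, ‖x i‖ ^ 2 ≤ quad (partialTranspose S (rho c t)) x := by
  rw [rho, partialTranspose_smul_X, quad_smul, mul_assoc]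
  refine mul_le_mul_of_nonneg_left (le_quad_X (fun i => ?_) x) (by positivity)
  simp [hc1, abs_of_nonneg ht]

lemma posSemidef_partialTranspose_rho [NeZero n] (hc : c ∈ VSa n) (hc1 : ∀ i, ‖c i‖ = 1) {t : ℝ}
    (ht : 0 ≤ t) (ht1 : t ≤ 1) (S : Finset (Fin n)) :
    (partialTranspose S (rho c t)).PosSemidef :=
  posSemidef_of_quad (isHermitian_partialTranspose (isHermitian_rho hc t) S) fun x =>
    (mul_nonneg (mul_nonneg (by positivity) (by linarith))
      (Finset.sum_nonneg fun i _ => by positivity)).trans (le_quad_partialTranspose_rho hc1 ht S x)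

lemma rho_mem_pptStates [NeZero n] (hc : c ∈ VSa n) (hc1 : ∀ i, ‖c i‖ = 1) {t : ℝ}
    (ht : 0 ≤ t) (ht1 : t ≤ 1) : rho c t ∈ pptStates n :=
  ⟨⟨by simpa only [partialTranspose_empty] using posSemidef_partialTranspose_rho hc hc1 ht ht1 ∅,
    trace_rho c t⟩, posSemidef_partialTranspose_rho hc hc1 ht ht1⟩

lemma le_one_of_rho_mem_states [NeZero n] (hc : c ∈ VSa n) (hc1 : ∀ i, ‖c i‖ = 1) {t : ℝ}
    (ht : 0 ≤ t) (h : rho c t ∈ states n) : t ≤ 1 := by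
  -- The principal minor on the indices `0` and `bar 0` is `4⁻ⁿ(1 - t²)`.
  have h1 := (h.1.submatrix ![0, bar 0]).det_nonneg
  have hcc : c 0 * star (c 0) = 1 := by simpa [hc1 0] using Complex.mul_conj' (c 0)
  rw [Matrix.det_fin_two] at h1
  have h2 : ((rho c t).submatrix ![0, bar 0] ![0, bar 0] 0 0 *
      (rho c t).submatrix ![0, bar 0] ![0, bar 0] 1 1 -
      (rho c t).submatrix ![0, bar 0] ![0, bar 0] 0 1 *
      (rho c t).submatrix ![0, bar 0] ![0, bar 0] 1 0) =
      (((((2 : ℝ) ^ n)⁻¹) ^ 2 * (1 - t ^ 2) : ℝ) : ℂ) := by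
    simp only [rho, X, Matrix.submatrix_apply, Matrix.cons_val_zero, Matrix.cons_val_one,
      Matrix.smul_apply, Matrix.of_apply, if_true, if_neg (bar_ne (0 : Idx n)),
      if_neg (bar_ne (0 : Idx n)).symm, bar_bar, Pi.one_apply, Pi.smul_apply, hc 0,
      Complex.real_smul]
    push_cast
    linear_combination (-(((2 : ℂ) ^ n)⁻¹) ^ 2 * t ^ 2) * hcc
  rw [h2, Complex.zero_le_real] at h1
  have h3 : (0 : ℝ) < ((((2 : ℝ) ^ n)⁻¹) ^ 2) := by positivity
  have h4 := nonneg_of_mul_nonneg_right h1 h3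
  nlinarith

lemma rho_mem_saTraceOne [NeZero n] (hc : c ∈ VSa n) (t : ℝ) : rho c t ∈ saTraceOne n :=
  ⟨isHermitian_rho hc t, trace_rho c t⟩

lemma posDef_partialTranspose_rho [NeZero n] (hc : c ∈ VSa n) (hc1 : ∀ i, ‖c i‖ = 1) {t : ℝ}
    (ht : 0 ≤ t) (ht1 : t < 1) (S : Finset (Fin n)) :
    (partialTranspose S (rho c t)).PosDef := by
  refine posDef_of_quad (isHermitian_partialTranspose (isHermitian_rho hc t) S) fun x hx => ?_
  refine lt_of_lt_of_le (mul_pos (mul_pos (by positivity) (by linarith)) ?_)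
    (le_quad_partialTranspose_rho hc1 ht S x)
  obtain ⟨i, hi⟩ := Function.ne_iff.1 hx
  exact Finset.sum_pos' (fun i _ => by positivity)
    ⟨i, Finset.mem_univ i, pow_pos (norm_pos_iff.2 hi) 2⟩

lemma hasFullRanks_rho [NeZero n] (hc : c ∈ VSa n) (hc1 : ∀ i, ‖c i‖ = 1) {t : ℝ}
    (ht : 0 ≤ t) (ht1 : t < 1) : HasFullRanks (rho c t) := fun S => by
  rw [Matrix.rank_of_isUnit _ (posDef_partialTranspose_rho hc hc1 ht ht1 S).isUnit]
  simp

lemma rho_mem_relInterior_pptStates [NeZero n] (hc : c ∈ VSa n) (hc1 : ∀ i, ‖c i‖ = 1) {t : ℝ}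
    (ht : 0 ≤ t) (ht1 : t < 1) : rho c t ∈ relInterior (pptStates n) := by
  refine ⟨rho_mem_saTraceOne hc t, ?_⟩
  set m : ℝ := ((2 : ℝ) ^ n)⁻¹ * (1 - t) with hm
  have hm0 : 0 < m := mul_pos (by positivity) (by linarith)
  set ε : ℝ := m / 2 ^ n with hε
  have hε0 : 0 < ε := by positivity
  have hεm : ε * 2 ^ n ≤ m := by rw [hε, div_mul_cancel₀]; positivity
  have hev : ∀ᶠ σ : QMat n in 𝓝 (rho c t), ∀ i j, ‖σ i j - rho c t i j‖ < ε := by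
    refine Filter.eventually_all.2 fun i => Filter.eventually_all.2 fun j => ?_
    have hcont : Continuous fun σ : QMat n => ‖σ i j - rho c t i j‖ :=
      ((continuous_id.matrix_elem i j).sub continuous_const).norm
    refine hcont.continuousAt.eventually_lt continuousAt_const ?_
    simpa using hε0
  filter_upwards [nhdsWithin_le_nhds hev, self_mem_nhdsWithin] with σ hσ hsa
  have key : ∀ S : Finset (Fin n), (partialTranspose S σ).PosSemidef := fun S =>
    posSemidef_of_near (le_quad_partialTranspose_rho hc1 ht S)
      (isHermitian_partialTranspose hsa.1 S) hεm fun i j => (hσ _ _).le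
  exact ⟨⟨by simpa only [partialTranspose_empty] using key ∅, hsa.2⟩, key⟩

lemma continuous_rho (c : Idx n → ℂ) : Continuous (rho c) := by
  refine continuous_matrix fun i j => ?_
  simp only [rho, X, Matrix.smul_apply, Matrix.of_apply, Pi.smul_apply]
  split_ifs <;> fun_prop

/-- The curve stays in the affine space and leaves `A` immediately after `t₀`. -/
lemma rho_mem_relBoundary [NeZero n] (hc : c ∈ VSa n) {t₀ : ℝ} {A : Set (QMat n)}
    (h₀ : rho c t₀ ∈ A) (h : ∀ t, t₀ < t → rho c t ∉ A) : rho c t₀ ∈ relBoundary A := by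
  refine ⟨h₀, fun hint => ?_⟩
  have ht : Filter.Tendsto (rho c) (𝓝[>] t₀) (𝓝[saTraceOne n] (rho c t₀)) :=
    tendsto_nhdsWithin_iff.2 ⟨((continuous_rho c).tendsto t₀).mono_left nhdsWithin_le_nhds,
      Filter.Eventually.of_forall fun t => rho_mem_saTraceOne hc t⟩
  have h2 : ∀ᶠ t in 𝓝[>] t₀, rho c t ∈ A := ht hint.2
  obtain ⟨t, hA, hlt⟩ := (h2.and self_mem_nhdsWithin).exists
  exact h t hlt hA

lemma rho_mem_criterionStates_iff [NeZero n] (c : Idx n → ℂ) (t : ℝ) :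
    rho c t ∈ criterionStates n ↔
      rho c t ∈ states n ∧ xDualNorm (t • c) ≤ Delta (1 : Idx n → ℝ) := by
  have hd : diagPart (rho c t) = ((2 : ℝ) ^ n)⁻¹ • (1 : Idx n → ℝ) := by
    funext i
    simp only [diagPart, rho, X, Matrix.smul_apply, Matrix.of_apply, if_true, Complex.smul_re,
      Pi.one_apply, Complex.ofReal_one, Complex.one_re, Pi.smul_apply]
  have ha : antidiagPart (rho c t) = ((2 : ℝ) ^ n)⁻¹ • (t • c) := by
    funext i
    simp [antidiagPart, rho, X, bar_ne]
  have hp : (0 : ℝ) < ((2 : ℝ) ^ n)⁻¹ := by positivity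
  rw [criterionStates, Set.mem_ofPred_eq, hd, ha, Delta_smul hp.le, xDualNorm_smul hp.le, ge_iff_le,
    mul_le_mul_iff_right₀ hp]

end Families

/-! ### Convexity and closedness of the criterion set -/

section Criterion

variable {n : ℕ}

lemma convex_states : Convex ℝ (states n) := fun x hx y hy a b ha hb hab => by
  refine ⟨(hx.1.smul ha).add (hy.1.smul hb), ?_⟩
  rw [Matrix.trace_add, Matrix.trace_smul, Matrix.trace_smul, hx.2, hy.2, ← add_smul, hab, one_smul]

lemma convex_pptStates : Convex ℝ (pptStates n) := fun _ hx _ hy _ _ ha hb hab =>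
  ⟨convex_states hx.1 hy.1 ha hb hab, fun S => ((hx.2 S).smul ha).add ((hy.2 S).smul hb)⟩

lemma isClosed_states : IsClosed (states n) := by
  have h : states n = {ρ | ρ.conjTranspose = ρ} ∩
      (⋂ x : Idx n → ℂ, {ρ | 0 ≤ star x ⬝ᵥ ρ.mulVec x}) ∩ {ρ | ρ.trace = 1} := by
    ext ρ
    simp only [states, Matrix.posSemidef_iff_dotProduct_mulVec, Set.mem_ofPred_eq, Set.mem_inter_iff,
      Set.mem_iInter, Matrix.IsHermitian]
  rw [h]
  refine (IsClosed.inter ?_ (isClosed_iInter fun x => ?_)).inter ?_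
  · exact isClosed_eq continuous_id.matrix_conjTranspose continuous_id
  · exact isClosed_le continuous_const
      (continuous_const.dotProduct (continuous_id.matrix_mulVec continuous_const))
  · exact isClosed_eq continuous_id.matrix_trace continuous_const

lemma mem_criterionStates_iff [NeZero n] {ρ : QMat n} : ρ ∈ criterionStates n ↔ ρ ∈ states n ∧
    ∀ s ∈ VPos n, delta s = 1 → ∀ u ∈ VSa n, xNorm u = 1 →
      (∑ i, u i * antidiagPart ρ i).re ≤ ∑ i, s i * diagPart ρ i :=
  and_congr_right fun h => xDualNorm_le_Delta_iff
    (fun _ => (Complex.nonneg_iff.1 h.1.diag_nonneg).1) _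

lemma isClosed_criterionStates [NeZero n] : IsClosed (criterionStates n) := by
  have h : criterionStates n = states n ∩ ⋂ s ∈ VPos n, ⋂ (_ : delta s = 1), ⋂ u ∈ VSa n,
      ⋂ (_ : xNorm u = 1), {ρ | (∑ i, u i * antidiagPart ρ i).re ≤ ∑ i, s i * diagPart ρ i} := by
    ext ρ
    simp only [mem_criterionStates_iff, Set.mem_inter_iff, Set.mem_iInter, Set.mem_ofPred_eq]
  rw [h]
  refine isClosed_states.inter (isClosed_iInter fun s => isClosed_iInter fun _ =>
    isClosed_iInter fun _ => isClosed_iInter fun u => isClosed_iInter fun _ =>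
    isClosed_iInter fun _ => isClosed_le ?_ ?_)
  · exact Complex.continuous_re.comp (continuous_finsetSum _ fun i _ =>
      continuous_const.mul (continuous_id.matrix_elem i (bar i)))
  · exact continuous_finsetSum _ fun i _ => continuous_const.mul
      (Complex.continuous_re.comp (continuous_id.matrix_elem i i))

lemma convex_criterionStates [NeZero n] : Convex ℝ (criterionStates n) := by
  intro x hx y hy a b ha hb hab
  rw [mem_criterionStates_iff] at hx hy ⊢
  refine ⟨convex_states hx.1 hy.1 ha hb hab, fun s hs hs1 u hu hu1 => ?_⟩
  have h1 : (∑ i, u i * antidiagPart (a • x + b • y) i).re =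
      a * (∑ i, u i * antidiagPart x i).re + b * (∑ i, u i * antidiagPart y i).re := by
    have : antidiagPart (a • x + b • y) = a • antidiagPart x + b • antidiagPart y := rfl
    rw [this]
    simp only [mul_comm (u _), ← re_pairing_smul]
    simp only [Pi.add_apply, add_mul, Finset.sum_add_distrib, Complex.add_re]
  have h2 : ∑ i, s i * diagPart (a • x + b • y) i =
      a * ∑ i, s i * diagPart x i + b * ∑ i, s i * diagPart y i := by
    rw [Finset.mul_sum, Finset.mul_sum, ← Finset.sum_add_distrib]
    refine Finset.sum_congr rfl fun i _ => ?_
    simp only [diagPart, Matrix.add_apply, Matrix.smul_apply, Complex.add_re, Complex.smul_re,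
      smul_eq_mul]
    ring
  rw [h1, h2]
  exact add_le_add (mul_le_mul_of_nonneg_left (hx.2 s hs hs1 u hu hu1) ha)
    (mul_le_mul_of_nonneg_left (hy.2 s hs hs1 u hu hu1) hb)

end Criterion

/-! ### Product states: necessity, and separable X-states -/

section Separable

variable {n : ℕ}

lemma sum_prod_idx {R : Type*} [CommSemiring R] (f : Fin n → Fin 2 → R) :
    ∑ m : Idx n, ∏ k, f k (m k) = ∏ k, (f k 0 + f k 1) := by
  have h := Finset.prod_univ_sum (fun _ : Fin n => (Finset.univ : Finset (Fin 2))) f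
  rw [Fintype.piFinset_univ] at h
  rw [← h]
  simp only [Fin.sum_univ_two]

lemma tensor_vecMulVec (x : Fin n → Fin 2 → ℂ) :
    (tensor fun k => Matrix.vecMulVec (x k) (star (x k))) =
      Matrix.vecMulVec (fun i => ∏ k, x k (i k)) (star fun i => ∏ k, x k (i k)) := by
  ext i j
  simp [tensor, Matrix.vecMulVec_apply, Finset.prod_mul_distrib]

lemma pureProductStates_subset_states : pureProductStates n ⊆ states n := by
  rintro _ ⟨x, hx, rfl⟩
  rw [tensor_vecMulVec]
  refine ⟨Matrix.posSemidef_vecMulVec_self_star _, ?_⟩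
  have h : ∀ i : Idx n, Matrix.vecMulVec (fun i : Idx n => ∏ k, x k (i k))
      (star fun i => ∏ k, x k (i k)) i i = ∏ k, ((‖x k (i k)‖ ^ 2 : ℝ) : ℂ) := fun i => by
    simp only [Matrix.vecMulVec_apply, Pi.star_apply, star_prod, ← Finset.prod_mul_distrib]
    refine Finset.prod_congr rfl fun k _ => ?_
    simpa using Complex.mul_conj' (x k (i k))
  simp only [Matrix.trace, Matrix.diag_apply, h]
  rw [sum_prod_idx fun k b => ((‖x k b‖ ^ 2 : ℝ) : ℂ)]
  refine Finset.prod_eq_one fun k _ => ?_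
  rw [← Complex.ofReal_add, ← Fin.sum_univ_two fun b => ‖x k b‖ ^ 2, hx k, Complex.ofReal_one]

/-- Transposing a rank-one projection conjugates its vector. -/
lemma partialTranspose_mem_pureProductStates {ρ : QMat n} (hρ : ρ ∈ pureProductStates n)
    (S : Finset (Fin n)) : partialTranspose S ρ ∈ pureProductStates n := by
  obtain ⟨x, hx, rfl⟩ := hρ
  refine ⟨fun k => if k ∈ S then star (x k) else x k, fun k => ?_, ?_⟩
  · by_cases hk : k ∈ S
    · simpa only [if_pos hk, Pi.star_apply, norm_star] using hx k
    · simpa only [if_neg hk] using hx k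
  · ext i j
    simp only [partialTranspose, tensor, Matrix.of_apply, Matrix.vecMulVec_apply]
    refine Finset.prod_congr rfl fun k _ => ?_
    by_cases hk : k ∈ S <;> simp [hk, mul_comm]

lemma pureProductStates_subset_pptStates : pureProductStates n ⊆ pptStates n := fun _ hρ =>
  ⟨pureProductStates_subset_states hρ, fun S =>
    (pureProductStates_subset_states (partialTranspose_mem_pureProductStates hρ S)).1⟩

/-- The X-part of a pure product state is proportional to a pair of monomial vectors, or its
anti-diagonal vanishes. -/
lemma exists_monom_of_mem_pureProductStates {ρ : QMat n} (hρ : ρ ∈ pureProductStates n) :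
    antidiagPart ρ = 0 ∨ ∃ (p : ℝ) (r : Fin n → ℝ) (α : Fin n → ℂ), 0 ≤ p ∧ (∀ k, 0 < r k) ∧
      (∀ k, ‖α k‖ = 1) ∧ diagPart ρ = p • monom r ∧ antidiagPart ρ = p • monom α := by
  obtain ⟨x, -, rfl⟩ := hρ
  by_cases h : ∃ k b, x k b = 0
  · left
    obtain ⟨k, b, hkb⟩ := h
    funext i
    -- The `k`-th factor of an anti-diagonal entry always involves both coordinates of `x k`.
    refine Finset.prod_eq_zero (Finset.mem_univ k) ?_
    simp only [Matrix.vecMulVec_apply, bar, Pi.star_apply]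
    rcases (by omega : i k = b ∨ i k + 1 = b) with h | h <;> simp [h, hkb]
  · right
    push Not at h
    have hn : ∀ k b, ‖x k b‖ ≠ 0 := fun k b => norm_ne_zero_iff.2 (h k b)
    have hc : ∀ k b, ((‖x k b‖ : ℝ) : ℂ) ≠ 0 := fun k b => Complex.ofReal_ne_zero.2 (hn k b)
    have hxx : ∀ k b, star (x k b) = (‖x k b‖ : ℂ) ^ 2 / x k b := fun k b => by
      rw [eq_div_iff (h k b)]
      exact Complex.conj_mul' (x k b)
    -- From `|x₀|² = |x₀||x₁| · (|x₀|/|x₁|)`, the same with indices swapped, and the polar form of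
    -- `x₀ x̄₁`.
    refine ⟨∏ k, (‖x k 0‖ * ‖x k 1‖), fun k => ‖x k 0‖ / ‖x k 1‖,
      fun k => x k 0 * star (x k 1) / (‖x k 0‖ * ‖x k 1‖ : ℝ),
      Finset.prod_nonneg fun k _ => by positivity, fun k => ?_, fun k => ?_, ?_, ?_⟩
    · exact div_pos ((norm_nonneg _).lt_of_ne (hn k 0).symm) ((norm_nonneg _).lt_of_ne (hn k 1).symm)
    · rw [norm_div, norm_mul, norm_star, Complex.norm_real, norm_mul, norm_norm, norm_norm]
      exact div_self (mul_ne_zero (hn k 0) (hn k 1))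
    · funext i
      have h1 : ∀ k b, x k b * star (x k b) = ((‖x k b‖ ^ 2 : ℝ) : ℂ) := fun k b => by
        simpa using Complex.mul_conj' (x k b)
      simp only [diagPart, tensor, Matrix.of_apply, Matrix.vecMulVec_apply, Pi.star_apply, h1,
        Pi.smul_apply, monom, smul_eq_mul]
      rw [← Complex.ofReal_prod, Complex.ofReal_re, ← Finset.prod_mul_distrib]
      refine Finset.prod_congr rfl fun k _ => ?_
      have h2 := hn k 0
      have h3 := hn k 1
      rcases (by omega : i k = 0 ∨ i k = 1) with h | h <;> norm_num [h] <;> field_simp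
    · funext i
      simp only [antidiagPart, tensor, Matrix.of_apply, Matrix.vecMulVec_apply, Pi.star_apply,
        Pi.smul_apply, monom, Complex.real_smul, Complex.ofReal_prod, bar]
      rw [← Finset.prod_mul_distrib]
      refine Finset.prod_congr rfl fun k _ => ?_
      have h2 := hc k 0
      have h3 := hc k 1
      have h4 := h k 0
      have h5 := h k 1
      rcases (by omega : i k = 0 ∨ i k = 1) with h | h
      · rw [h]
        norm_num
        field_simp
      · rw [h, show (1 : Fin 2) + 1 = 0 from rfl]
        norm_num
        have h6 := hxx k 0
        have h7 := hxx k 1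
        simp only [Complex.star_def] at h6 h7
        rw [h6, h7]
        field_simp

lemma pureProductStates_subset_criterionStates [NeZero n] :
    pureProductStates n ⊆ criterionStates n := by
  intro ρ hρ
  rw [mem_criterionStates_iff]
  have hst := pureProductStates_subset_states hρ
  refine ⟨hst, fun s hs hs1 u hu hu1 => ?_⟩
  rcases exists_monom_of_mem_pureProductStates hρ with h | ⟨p, r, α, hp, hr, hα, hd, ha⟩
  · rw [h]
    simp only [Pi.zero_apply, mul_zero, Finset.sum_const_zero, Complex.zero_re]
    exact Finset.sum_nonneg fun i _ =>
      mul_nonneg (hs i) (Complex.nonneg_iff.1 hst.1.diag_nonneg).1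
  · have h1 := le_xNorm u hα
    have h2 := delta_le hs hr
    rw [hd, ha]
    have h3 : (∑ i, u i * (p • monom α) i).re = p * (∑ i, u i * monom α i).re := by
      simp only [mul_comm (u _), re_pairing_smul]
    have h4 : ∑ i, s i * (p • monom r) i = p * ∑ i, s i * monom r i := by
      simp only [Pi.smul_apply, smul_eq_mul, Finset.mul_sum, mul_left_comm]
    rw [h3, h4]
    exact mul_le_mul_of_nonneg_left (by linarith) hp

lemma separableStates_subset [NeZero n] :
    separableStates n ⊆ criterionStates n ∩ pptStates n :=
  convexHull_min (Set.subset_inter pureProductStates_subset_criterionStates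
    pureProductStates_subset_pptStates) (convex_criterionStates.inter convex_pptStates)

/-- The sign character of `ℤ/2`. -/
def sgn (b : Fin 2) : ℝ := if b = 0 then 1 else -1

/-- The unit vectors `(1, sgn b * conj z) / √2`. -/
noncomputable def phaseVector (z : ℂ) (b : Fin 2) : Fin 2 → ℂ :=
  fun d => if d = 0 then (√2⁻¹ : ℝ) else (√2⁻¹ : ℝ) * (sgn b * star z)

lemma norm_phaseVector {z : ℂ} (hz : ‖z‖ = 1) (b : Fin 2) :
    ∑ d, ‖phaseVector z b d‖ ^ 2 = 1 := by
  have h : √(2⁻¹ : ℝ) ^ 2 = 2⁻¹ := Real.sq_sqrt (by norm_num)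
  rcases (by omega : b = 0 ∨ b = 1) with rfl | rfl <;>
  · simp only [Fin.sum_univ_two, phaseVector, sgn, if_true, one_ne_zero, if_false, norm_mul,
      Complex.norm_real, norm_star, hz, Real.norm_eq_abs, mul_pow, sq_abs, h]
    norm_num

lemma sum_phaseVector {z : ℂ} (hz : ‖z‖ = 1) (i j : Fin 2) :
    Matrix.vecMulVec (phaseVector z 0) (star (phaseVector z 0)) i j +
      Matrix.vecMulVec (phaseVector z 1) (star (phaseVector z 1)) i j = if j = i then 1 else 0 := by
  have h : ((√(2⁻¹ : ℝ) : ℝ) : ℂ) * ((√(2⁻¹ : ℝ) : ℝ) : ℂ) = 2⁻¹ := by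
    rw [← Complex.ofReal_mul, Real.mul_self_sqrt (by norm_num)]; norm_num
  have hzz : star z * z = 1 := by simpa [hz] using Complex.conj_mul' z
  simp only [Complex.star_def] at hzz
  rcases (by omega : i = 0 ∨ i = 1) with rfl | rfl <;>
  rcases (by omega : j = 0 ∨ j = 1) with rfl | rfl <;>
  simp only [Matrix.vecMulVec_apply, Pi.star_apply, phaseVector, sgn, if_true, one_ne_zero, if_false,
    zero_ne_one, Complex.star_def, map_mul, Complex.conj_ofReal, Complex.conj_conj,
    Complex.ofReal_one, Complex.ofReal_neg, map_one, map_neg]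
  · linear_combination 2 * h
  · ring
  · ring
  · linear_combination 2 * h * (starRingEnd ℂ z * z) + hzz

/-- The signed sum of the two projections keeps only the anti-diagonal, with entries `z` and `z⁻¹`,
whereas the unsigned sum is the identity. -/
lemma sum_sgn_phaseVector {z : ℂ} (hz : ‖z‖ = 1) (i j : Fin 2) :
    (sgn 0 : ℂ) * Matrix.vecMulVec (phaseVector z 0) (star (phaseVector z 0)) i j +
      (sgn 1 : ℂ) * Matrix.vecMulVec (phaseVector z 1) (star (phaseVector z 1)) i j =
      if j = i + 1 then z ^ ((1 : ℤ) - 2 * ((i : ℕ) : ℤ)) else 0 := by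
  have h : ((√(2⁻¹ : ℝ) : ℝ) : ℂ) * ((√(2⁻¹ : ℝ) : ℝ) : ℂ) = 2⁻¹ := by
    rw [← Complex.ofReal_mul, Real.mul_self_sqrt (by norm_num)]; norm_num
  have hzz : z⁻¹ = starRingEnd ℂ z := Complex.inv_eq_conj hz
  simp only [Matrix.vecMulVec_apply, Pi.star_apply, phaseVector, sgn, if_true, one_ne_zero, if_false,
    Complex.ofReal_one, Complex.ofReal_neg]
  rcases (by omega : i = 0 ∨ i = 1) with rfl | rfl <;>
  rcases (by omega : j = 0 ∨ j = 1) with rfl | rfl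
  · rw [if_neg (show ¬ (0 : Fin 2) = 0 + 1 by decide)]
    simp only [if_true]
    ring
  · rw [if_pos (show (1 : Fin 2) = 0 + 1 by decide),
      show (1 : ℤ) - 2 * (((0 : Fin 2) : ℕ) : ℤ) = 1 from rfl, zpow_one]
    simp only [if_true, one_ne_zero, if_false, Complex.star_def, map_mul, Complex.conj_ofReal,
      Complex.conj_conj, map_one, map_neg]
    linear_combination 2 * z * h
  · rw [if_pos (show (0 : Fin 2) = 1 + 1 by decide),
      show (1 : ℤ) - 2 * (((1 : Fin 2) : ℕ) : ℤ) = -1 from rfl, zpow_neg_one,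
      hzz]
    simp only [if_true, one_ne_zero, if_false, Complex.star_def, Complex.conj_ofReal]
    linear_combination 2 * starRingEnd ℂ z * h
  · rw [if_neg (show ¬ (1 : Fin 2) = 1 + 1 by decide)]
    simp only [one_ne_zero, if_false, Complex.star_def, map_mul, Complex.conj_ofReal,
      Complex.conj_conj, map_one, map_neg]
    ring

lemma prod_ite_all {R ι : Type*} [Fintype ι] [CommMonoidWithZero R] (p : ι → Prop)
    [DecidablePred p] [Decidable (∀ k, p k)] (f : ι → R) :
    ∏ k, (if p k then f k else 0) = if ∀ k, p k then ∏ k, f k else 0 := by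
  split_ifs with h
  · exact Finset.prod_congr rfl fun k _ => if_pos (h k)
  · push Not at h
    obtain ⟨k, hk⟩ := h
    exact Finset.prod_eq_zero (Finset.mem_univ k) (if_neg hk)

/-- Averaging product states over signs with product one leaves an X-shaped state. -/
lemma X_monom_mem_separableStates [NeZero n] {α : Fin n → ℂ} (hα : ∀ k, ‖α k‖ = 1) :
    ((2 : ℝ) ^ n)⁻¹ • X 1 (monom α) ∈ separableStates n := by
  set P : Idx n → QMat n := fun e => tensor fun k =>
    Matrix.vecMulVec (phaseVector (α k) (e k)) (star (phaseVector (α k) (e k))) with hP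
  have hmem : ∀ e, P e ∈ separableStates n := fun e =>
    subset_convexHull ℝ _ ⟨fun k => phaseVector (α k) (e k), fun k => norm_phaseVector (hα k) _, rfl⟩
  have hs1 : ∑ e : Idx n, ∏ k, sgn (e k) = 0 := by
    rw [sum_prod_idx fun _ b => sgn b]
    exact Finset.prod_eq_zero (Finset.mem_univ 0) (by norm_num [sgn])
  have hsgn : ∀ e : Idx n, |∏ k, sgn (e k)| = 1 := fun e => by
    rw [Finset.abs_prod]
    exact Finset.prod_eq_one fun k _ => by unfold sgn; split_ifs <;> simp
  -- The weight vanishes unless the signs multiply to `1`. Its constant term yields the diagonal,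
  -- its sign term the anti-diagonal.
  have hsum : ∑ e : Idx n, (((2 : ℝ) ^ n)⁻¹ * (1 + ∏ k, sgn (e k))) • P e =
      ((2 : ℝ) ^ n)⁻¹ • X 1 (monom α) := by
    simp only [mul_smul, ← Finset.smul_sum]
    congr 1
    ext i j
    have h1 : ∑ e : Idx n, P e i j = if j = i then 1 else 0 := by
      simp only [hP, tensor, Matrix.of_apply]
      rw [sum_prod_idx fun k b => Matrix.vecMulVec (phaseVector (α k) b)
        (star (phaseVector (α k) b)) (i k) (j k)]
      simp only [sum_phaseVector (hα _)]
      rw [prod_ite_all]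
      simp only [funext_iff, Finset.prod_const_one]
    have h2 : ∑ e : Idx n, (∏ k, (sgn (e k) : ℂ)) * P e i j =
        if j = bar i then monom α i else 0 := by
      simp only [hP, tensor, Matrix.of_apply, ← Finset.prod_mul_distrib]
      rw [sum_prod_idx fun k b => (sgn b : ℂ) * Matrix.vecMulVec (phaseVector (α k) b)
        (star (phaseVector (α k) b)) (i k) (j k)]
      simp only [sum_sgn_phaseVector (hα _)]
      rw [prod_ite_all]
      simp only [funext_iff, bar, monom]
    simp only [add_smul, one_smul, Finset.sum_add_distrib, Matrix.add_apply, Matrix.sum_apply,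
      Matrix.smul_apply, Complex.real_smul, Complex.ofReal_prod, h1, h2, X, Matrix.of_apply]
    by_cases hji : j = i
    · subst hji; simp [(bar_ne j).symm]
    · simp [hji]
  rw [← hsum]
  refine (convex_convexHull ℝ _).sum_mem (fun e _ => ?_) ?_ fun e _ => hmem e
  · have := (abs_le.1 (hsgn e).le).1
    exact mul_nonneg (by positivity) (by linarith)
  · rw [← Finset.mul_sum, Finset.sum_add_distrib, hs1]
    simp

lemma X_mem_separableStates_of_mem_convexHull [NeZero n] {c : Idx n → ℂ}
    (h : c ∈ convexHull ℝ {v : Idx n → ℂ | ∃ α : Fin n → ℂ, (∀ k, ‖α k‖ = 1) ∧ v = monom α}) :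
    ((2 : ℝ) ^ n)⁻¹ • X 1 c ∈ separableStates n := by
  refine convexHull_min (t := {v | ((2 : ℝ) ^ n)⁻¹ • X 1 v ∈ separableStates n}) ?_ ?_ h
  · rintro _ ⟨α, hα, rfl⟩
    exact X_monom_mem_separableStates hα
  · intro v hv w hw a b ha hb hab
    have := convex_convexHull ℝ (pureProductStates n) hv hw ha hb hab
    have hX : ((2 : ℝ) ^ n)⁻¹ • X 1 (a • v + b • w) =
        a • ((2 : ℝ) ^ n)⁻¹ • X 1 v + b • ((2 : ℝ) ^ n)⁻¹ • X 1 w := ?_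
    · rw [Set.mem_ofPred_eq, hX]
      exact this
    rw [smul_comm a, smul_comm b, ← smul_add]
    congr 1
    ext i j
    -- The fixed diagonal makes the map affine rather than linear.
    have hab' : (a : ℂ) + b = 1 := by exact_mod_cast hab
    simp only [X, Matrix.add_apply, Matrix.smul_apply, Matrix.of_apply]
    split_ifs <;> simp [hab']

end Separable

/-! ### When nontrivial phase differences exist -/

section PhaseDifference

variable {n : ℕ}

lemma idx_two_cases (i : Idx 2) : i = 0 ∨ i = bar 0 ∨ i = ![0, 1] ∨ i = bar ![0, 1] := by
  revert i
  decide

lemma trivialPhaseDifference_of_le_two [NeZero n] (hn : n ≤ 2) {c : Idx n → ℂ} (hc : c ∈ VSa n)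
    (hc1 : ∀ i, ‖c i‖ = 1) : TrivialPhaseDifference c := by
  have hexp : ∀ i, Complex.exp ((c i).arg * Complex.I) = c i := fun i => by
    have := Complex.norm_mul_exp_arg_mul_I (c i)
    simpa [hc1 i] using this
  have hbar : ∀ i, c (bar i) = (c i)⁻¹ := fun i => by
    rw [hc i]
    exact (Complex.inv_eq_conj (hc1 i)).symm
  have key : ∀ (x : Fin n → ℝ) (i : Idx n), Theta n x i = (c i).arg →
      monom (fun k => Complex.exp (x k * Complex.I)) i = c i ∧
      monom (fun k => Complex.exp (x k * Complex.I)) (bar i) = c (bar i) := fun x i h => by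
    have h1 : monom (fun k => Complex.exp (x k * Complex.I)) i = c i := by
      rw [monom_eq_exp, h, hexp]
    exact ⟨h1, by rw [monom_bar, h1, hbar]⟩
  rw [trivialPhaseDifference_iff hc1]
  have hn0 := NeZero.ne n
  rcases (by omega : n = 1 ∨ n = 2) with rfl | rfl
  · refine ⟨fun k => Complex.exp (((fun _ => (c 0).arg : Fin 1 → ℝ) k) * Complex.I),
      fun k => Complex.norm_exp_ofReal_mul_I _, funext fun i => ?_⟩
    have := key (fun _ => (c 0).arg) 0 (by
      simp [Theta, Matrix.mulVec, dotProduct])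
    have hi : i = 0 ∨ i = bar 0 := by
      rcases (by omega : i 0 = 0 ∨ i 0 = 1) with h | h
      · exact Or.inl (funext fun k => by rw [Fin.fin_one_eq_zero k, h]; rfl)
      · exact Or.inr (funext fun k => by rw [Fin.fin_one_eq_zero k, h]; rfl)
    rcases hi with rfl | rfl
    exacts [this.1.symm, this.2.symm]
  -- Solves `x₀ + x₁ = arg c₀₀` and `x₀ - x₁ = arg c₀₁`; the other two entries follow by
  -- conjugation.
  · set x : Fin 2 → ℝ := ![((c 0).arg + (c ![0, 1]).arg) / 2, ((c 0).arg - (c ![0, 1]).arg) / 2]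
      with hx
    refine ⟨fun k => Complex.exp (x k * Complex.I),
      fun k => Complex.norm_exp_ofReal_mul_I _, funext fun i => ?_⟩
    have h0 := key x 0 (by
      simp [Theta, Matrix.mulVec, dotProduct, Fin.sum_univ_two, hx]; ring)
    have h1 := key x ![0, 1] (by
      simp [Theta, Matrix.mulVec, dotProduct, Fin.sum_univ_two, hx]; ring)
    have hi : i = 0 ∨ i = bar 0 ∨ i = ![0, 1] ∨ i = bar ![0, 1] :=
      idx_two_cases i
    rcases hi with rfl | rfl | rfl | rfl
    exacts [h0.1.symm, h0.2.symm, h1.1.symm, h1.2.symm]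

/-- In each coordinate the two sides carry the same pair of exponents. -/
lemma monom_four_term {K : Type*} [Field K] (z : Fin n → K) {k l : Fin n} (hkl : k ≠ l) :
    monom z 0 * monom z (Pi.single k 1 + Pi.single l 1) =
      monom z (Pi.single k 1) * monom z (Pi.single l 1) := by
  simp only [monom, ← Finset.prod_mul_distrib]
  refine Finset.prod_congr rfl fun m _ => ?_
  by_cases hk : m = k
  · subst hk
    simp [hkl, mul_comm]
  · by_cases hl : m = l
    · subst hl
      simp [hk, mul_comm]
    · simp [hk, hl]

lemma exists_not_trivialPhaseDifference (hn : 3 ≤ n) :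
    ∃ c ∈ VSa n, (∀ i, ‖c i‖ = 1) ∧ ¬ TrivialPhaseDifference c := by
  have hc1 : ∀ i : Idx n, ‖(if i = 0 ∨ i = bar 0 then (-1 : ℂ) else 1)‖ = 1 := fun i => by
    split_ifs <;> simp
  refine ⟨fun i => if i = 0 ∨ i = bar 0 then -1 else 1, fun i => ?_, hc1, ?_⟩
  · have : (bar i = 0 ∨ bar i = bar 0) ↔ (i = 0 ∨ i = bar 0) := by
      rw [bar_eq_iff, bar_injective.eq_iff, or_comm]
    simp only [this]
    split_ifs <;> simp
  · rw [trivialPhaseDifference_iff hc1]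
    rintro ⟨α, -, h⟩
    set k : Fin n := ⟨0, by omega⟩ with hk
    set l : Fin n := ⟨1, by omega⟩ with hl
    set m : Fin n := ⟨2, by omega⟩ with hm
    have hkl : k ≠ l := by simp [hk, hl]
    have hkm : m ≠ k := by simp [hk, hm]
    have hlm : m ≠ l := by simp [hl, hm]
    have key := monom_four_term α hkl
    -- A third qubit with digit `0` keeps the other three indices away from `bar 0`, so the
    -- four-term relation would read `-1 = 1`.
    have hv : ∀ i : Idx n, i m = 0 → i ≠ 0 → monom α i = 1 := fun i hi hi0 => by
      rw [← h]
      refine if_neg (not_or.2 ⟨hi0, fun hb => ?_⟩)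
      rw [hb] at hi
      simp [bar] at hi
    have h0 : monom α 0 = -1 := by rw [← h]; simp
    rw [h0, hv _ (by simp [hkm, hlm]) fun h => by simpa [hkl] using congrFun h k,
      hv _ (by simp [hkm]) fun h => by simpa using congrFun h k,
      hv _ (by simp [hlm]) fun h => by simpa using congrFun h l] at key
    norm_num at key

end PhaseDifference

/-! ### The separability threshold -/

section Thresholds

variable {n : ℕ} [NeZero n] {c : Idx n → ℂ}

lemma xDualNorm_le_Delta_one_iff (hc : c ∈ VSa n) (hc1 : ∀ i, ‖c i‖ = 1) {t : ℝ} (ht : 0 ≤ t) :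
    Delta (1 : Idx n → ℝ) ≥ xDualNorm (t • c) ↔ t ≤ 1 / xDualNorm c := by
  rw [Delta_one, xDualNorm_smul ht, ge_iff_le, le_div_iff₀ (xDualNorm_pos hc hc1)]

lemma rho_mem_separableStates (hc : c ∈ VSa n) (hc1 : ∀ i, ‖c i‖ = 1) {t : ℝ} (ht : 0 ≤ t)
    (h : t ≤ 1 / xDualNorm c) : rho c t ∈ separableStates n := by
  refine X_mem_separableStates_of_mem_convexHull
    (mem_convexHull_of_xDualNorm_le_one (smul_mem_VSa t hc) ?_)
  simpa only [Delta_one, ge_iff_le] using (xDualNorm_le_Delta_one_iff hc hc1 ht).2 h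

lemma rho_mem_criterionStates_inter_iff (hc : c ∈ VSa n) (hc1 : ∀ i, ‖c i‖ = 1) {t : ℝ}
    (ht : 0 ≤ t) : rho c t ∈ criterionStates n ∩ pptStates n ↔ t ≤ 1 / xDualNorm c :=
  ⟨fun h => (xDualNorm_le_Delta_one_iff hc hc1 ht).1 ((rho_mem_criterionStates_iff c t).1 h.1).2, fun h =>
    separableStates_subset (rho_mem_separableStates hc hc1 ht h)⟩

end Thresholds

end XState
theorem mainTheorem10 (n : ℕ) (hn : 1 ≤ n) :
    -- the criterion is necessary for separability, and the criterion set is convex and closed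
    (XState.separableStates n ⊆ XState.criterionStates n ∩ XState.pptStates n ∧
      Convex ℝ (XState.criterionStates n) ∧
      IsClosed (XState.criterionStates n)) ∧
    -- the one-parameter families
    (∀ c ∈ XState.VSa n, (∀ i, ‖c i‖ = 1) →
      (∀ t : ℝ, 0 ≤ t →
        (XState.rho c t ∈ XState.states n ↔ XState.rho c t ∈ XState.pptStates n) ∧
        (XState.rho c t ∈ XState.pptStates n ↔ t ≤ 1) ∧
        (XState.rho c t ∈ XState.separableStates n ↔
          XState.rho c t ∈ XState.criterionStates n ∩ XState.pptStates n) ∧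
        (XState.rho c t ∈ XState.criterionStates n ∩ XState.pptStates n ↔
          XState.Delta (1 : XState.Idx n → ℝ) ≥ XState.xDualNorm (t • c)) ∧
        (XState.Delta (1 : XState.Idx n → ℝ) ≥ XState.xDualNorm (t • c) ↔
          t ≤ 1 / XState.xDualNorm c)) ∧
      (¬ XState.TrivialPhaseDifference c →
        0 < 1 / XState.xDualNorm c ∧ 1 / XState.xDualNorm c < 1 ∧
        XState.rho c (1 / XState.xDualNorm c) ∈
          XState.relBoundary (XState.criterionStates n ∩ XState.pptStates n) ∧
        XState.rho c (1 / XState.xDualNorm c) ∈ XState.relBoundary (XState.separableStates n) ∧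
        XState.rho c (1 / XState.xDualNorm c) ∈ XState.relInterior (XState.pptStates n) ∧
        XState.HasFullRanks (XState.rho c (1 / XState.xDualNorm c)))) ∧
    -- nontrivial phase differences occur exactly from three qubits on
    ((∃ c ∈ XState.VSa n, (∀ i, ‖c i‖ = 1) ∧ ¬ XState.TrivialPhaseDifference c) ↔ 3 ≤ n) ∧
    -- PPT entanglement of nonzero volume is detected; boundary separable states of full ranks
    (3 ≤ n →
      (XState.relInterior
        (XState.pptStates n \ (XState.criterionStates n ∩ XState.pptStates n))).Nonempty ∧
      ∃ ρ ∈ XState.relBoundary (XState.separableStates n), XState.HasFullRanks ρ) := by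
  have : NeZero n := ⟨by omega⟩
  have hsub := XState.separableStates_subset (n := n)
  have hfamily : ∀ c ∈ XState.VSa n, (∀ i, ‖c i‖ = 1) → ¬ XState.TrivialPhaseDifference c →
      0 < 1 / XState.xDualNorm c ∧ 1 / XState.xDualNorm c < 1 ∧
      XState.rho c (1 / XState.xDualNorm c) ∈
        XState.relBoundary (XState.criterionStates n ∩ XState.pptStates n) ∧
      XState.rho c (1 / XState.xDualNorm c) ∈ XState.relBoundary (XState.separableStates n) ∧
      XState.rho c (1 / XState.xDualNorm c) ∈ XState.relInterior (XState.pptStates n) ∧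
      XState.HasFullRanks (XState.rho c (1 / XState.xDualNorm c)) := by
    intro c hc hc1 hne
    have h0 : 0 < 1 / XState.xDualNorm c := one_div_pos.2 (XState.xDualNorm_pos hc hc1)
    have h1 : 1 / XState.xDualNorm c < 1 := by
      rw [div_lt_one (XState.xDualNorm_pos hc hc1)]
      exact XState.one_lt_xDualNorm hc hc1 hne
    have hout : ∀ t, 1 / XState.xDualNorm c < t →
        XState.rho c t ∉ XState.criterionStates n ∩ XState.pptStates n := fun t ht h =>
      ht.not_ge ((XState.rho_mem_criterionStates_inter_iff hc hc1 (h0.trans ht).le).1 h)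
    have hS := XState.rho_mem_separableStates hc hc1 h0.le le_rfl
    exact ⟨h0, h1, XState.rho_mem_relBoundary hc (hsub hS) hout,
      XState.rho_mem_relBoundary hc hS fun t ht h => hout t ht (hsub h),
      XState.rho_mem_relInterior_pptStates hc hc1 h0.le h1,
      XState.hasFullRanks_rho hc hc1 h0.le h1⟩
  refine ⟨⟨hsub, XState.convex_criterionStates, XState.isClosed_criterionStates⟩,
    fun c hc hc1 => ⟨fun t ht => ?_, hfamily c hc hc1⟩, ⟨?_, XState.exists_not_trivialPhaseDifference⟩,
    fun hn3 => ?_⟩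
  · have hCT := XState.rho_mem_criterionStates_inter_iff hc hc1 ht
    have hD := XState.xDualNorm_le_Delta_one_iff hc hc1 ht
    have hle := fun h => XState.le_one_of_rho_mem_states hc hc1 ht h
    have hT : XState.rho c t ∈ XState.pptStates n ↔ t ≤ 1 :=
      ⟨fun h => hle h.1, XState.rho_mem_pptStates hc hc1 ht⟩
    exact ⟨⟨fun h => hT.2 (hle h), fun h => h.1⟩, hT,
      ⟨fun h => hsub h, fun h => XState.rho_mem_separableStates hc hc1 ht (hCT.1 h)⟩,
      hCT.trans hD.symm, hD⟩
  · rintro ⟨c, hc, hc1, hne⟩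
    by_contra hn3
    exact hne (XState.trivialPhaseDifference_of_le_two (by omega) hc hc1)
  · obtain ⟨c, hc, hc1, hne⟩ := XState.exists_not_trivialPhaseDifference hn3
    obtain ⟨h0, h1, -, hS, -, hR⟩ := hfamily c hc hc1 hne
    -- Beyond `t₀` the state avoids the closed set `𝒞`, and below `1` it is interior to `𝒯`; both
    -- persist nearby.
    obtain ⟨t, ht, ht1⟩ := exists_between h1
    have hint := XState.rho_mem_relInterior_pptStates hc hc1 (h0.trans ht).le ht1
    have hC : XState.rho c t ∉ XState.criterionStates n := fun h =>
      ht.not_ge ((XState.rho_mem_criterionStates_inter_iff hc hc1 (h0.trans ht).le).1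
        ⟨h, XState.rho_mem_pptStates hc hc1 (h0.trans ht).le ht1.le⟩)
    refine ⟨⟨XState.rho c t, hint.1, ?_⟩, _, hS, hR⟩
    filter_upwards [hint.2, nhdsWithin_le_nhds
      (XState.isClosed_criterionStates.isOpen_compl.mem_nhds hC)] with σ hσ hσC
    exact ⟨hσ, fun h => hσC h.1⟩
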